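/- A Hilbert–Hadamard space is a nonempty complete geodesic CAT(0) metric space all of whose tangent cones embed isometrically into real Hilbert spaces. A continuous field $\mathcal C$ of Hilbert–Hadamard spaces consists of a locally compact paracompact Hausdorff base space $Z$, a family $(\mathcal C_z)_{z\in Z}$ of Hilbert–Hadamard spaces (the fibers), and a set $\Gamma(\mathcal C)\subseteq\prod_{z\in Z}\mathcal C_z$ of continuous sections such that: (i) if $s_0(z)$ is the midpoint of $s_1(z)$ and $s_2(z)$ for all $z$, with $s_1,s_2\in\Gamma(\mathcal C)$, then $s_0\in\Gamma(\mathcal C)$; (ii) $\{s(z): s\in\Gamma(\mathcal C)\}$ is dense in $\mathcal C_z$ for each $z$; (iii) $\Gamma(\mathcal C)$ is mutually co-continuous, i.e. $z\mapsto d(s(z),s'(z))$ is continuous for all $s,s'\in\Gamma(\mathcal C)$; (iv) if $\Gamma(\mathcal C)\cup\{s\}$ is mutually co-continuous, then $s\in\Gamma(\mathcal C)$. A set $\Sigma$ of sections generates the set of all $s$ such that $\Sigma\cup\{s\}$ is mutually co-continuous. The field induced from $\mathcal C$ by a continuous map $f\colon Y\to Z$ has fibers $\mathcal C_{f(y)}$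 and continuous sections generated by $\{s\circ f: s\in\Gamma(\mathcal C)\}$; write $\mathcal C|_U$ for the field induced by an inclusion $U\subseteq Z$, and $\mathcal C|_{Z\times Y}$ for the one induced by the projection $Z\times Y\to Z$. The constant field $X_Z$ has all fibers equal to $X$ and $\Gamma(X_Z)=C(Z,X)$. A morphism $\mathcal C\to\mathcal D$ from a field over $Z$ to a field over $Y$ is a continuous map $h\colon Y\to Z$ with isometric embeddings $\varphi_y\colon\mathcal C_{h(y)}\to\mathcal D_y$ such that $(\varphi_y(s(h(y))))_{y}\in\Gamma(\mathcal D)$ for all $s\in\Gamma(\mathcal C)$; isomorphisms are the morphisms with a two-sided inverse. The field $\mathcal C$ is trivial if it is isomorphic to a constant field of Hilbert–Hadamard spaces, locally trivial if each $z\in Z$ has an open neighborhood $U$ with $\mathcal C|_U$ trivial, and second-countable if $Z$ and all fibers are second-countable. Let $(\Omega,\mu)$ be a standard (atomless) probability space, realized as a compact metrizable space with a Borel probability measure without point masses. The randomization $\mathcal C^{(\Omega,\mu)}$ of a second-countable continuous field $\mathcal C$ over $Z$ is the field over $Z$ with fibers $L^2(\Omega,\mu,\mathcal C_z)$ (classes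 of measurable maps $\xi\colon\Omega\to\mathcal C_z$ with $\int d(\xi,x_0)^2\,d\mu<\infty$ for $x_0\in\mathcal C_z$, with metric $d(\xi,\eta)=(\int d(\xi(\omega),\eta(\omega))^2\,d\mu(\omega))^{1/2}$), whose continuous sections are generated by the sections $z\mapsto[s(z,\cdot)]$ with $s\in\Gamma(\mathcal C|_{Z\times\Omega})$. A continuous field is randomization-stable if it is second-countable and isomorphic to its randomization. **Theorem.** Let $\mathcal C$ be a continuous field of Hilbert–Hadamard spaces. 1. If $\mathcal C$ is randomization-stable, then $\mathcal C$ is trivial if and only if $\mathcal C$ is locally trivial and all fibers $\mathcal C_z$ are isometric to one and the same Hilbert–Hadamard space. 2. If $\mathcal C$ is second-countable and locally trivial, and all fibers $\mathcal C_z$ are isometric to one and the same Hilbert–Hadamard space, then the randomization $\mathcal C^{(\Omega,\mu)}$ is trivial. -/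

import Mathlib

open Set Filter Topology MeasureTheory
open scoped ENNReal NNReal

universe u v w u' v' u'' v''

noncomputable section

/-! ### Hilbert--Hadamard spaces -/

section HilbertHadamard

variable {X : Type*} [MetricSpace X]

/-- `m` is a midpoint of `q` and `r`. -/
def IsMidpoint (m q r : X) : Prop :=
  dist q m = dist q r / 2 ∧ dist r m = dist q r / 2

variable (X) in
/-- The CAT(0) condition, in the form of the CN inequality of Bruhat and Tits. -/
def IsCAT0 : Prop :=
  ∀ p q r m : X, IsMidpoint m q r →
    dist p q ^ 2 + dist p r ^ 2 ≥ 2 * dist m p ^ 2 + dist q r ^ 2 / 2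

/-- `γ` restricts on `[0,1]` to an affinely parametrized geodesic segment of length `ℓ`. -/
def IsGeodesicSegment (γ : ℝ → X) (ℓ : ℝ) : Prop :=
  ∀ s ∈ Icc (0 : ℝ) 1, ∀ t ∈ Icc (0 : ℝ) 1, dist (γ s) (γ t) = |s - t| * ℓ

variable (X) in
/-- Any two points are joined by a geodesic segment. -/
def IsGeodesicSpace : Prop :=
  ∀ x y : X, ∃ γ : ℝ → X, γ 0 = x ∧ γ 1 = y ∧ IsGeodesicSegment γ (dist x y)

/-- The comparison angle at `y` of the triple `x, y, z`. -/
def comparisonAngle (x y z : X) : ℝ :=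
  Real.arccos ((dist x y ^ 2 + dist y z ^ 2 - dist x z ^ 2) / (2 * dist x y * dist y z))

/-- Nontrivial geodesic segments emanating from `p`. The values of `toFun` outside `[0,1]` are
irrelevant. -/
structure GeodesicFrom (p : X) where
  toFun : ℝ → X
  source : toFun 0 = p
  geodesic : ∃ ℓ : ℝ, 0 < ℓ ∧ IsGeodesicSegment toFun ℓ

/-- The angle between two nontrivial geodesic segments emanating from `p`: the limit of the
comparison angles `∠ (α s) p (β t)` as `s, t → 0`. (The limit exists in a geodesic CAT(0) space.) -/
def GeodesicFrom.angle {p : X} (α β : GeodesicFrom p) : ℝ :=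
  limUnder (𝓝[>] (0 : ℝ) ×ˢ 𝓝[>] (0 : ℝ))
    fun q : ℝ × ℝ => comparisonAngle (α.toFun q.1) p (β.toFun q.2)

/-- Representatives of points of the space of directions at `p`, i.e. of the completion of the
space of geodesic germs with respect to the angle metric: sequences of nontrivial geodesic segments
emanating from `p` that are Cauchy for the angle. -/
structure SpaceOfDirections (p : X) where
  seq : ℕ → GeodesicFrom p
  cauchy : ∀ ε : ℝ, 0 < ε → ∃ N : ℕ, ∀ m ≥ N, ∀ n ≥ N, (seq m).angle (seq n) < ε

/-- The distance in the space of directions. -/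
def SpaceOfDirections.angle {p : X} (a b : SpaceOfDirections p) : ℝ :=
  limUnder atTop fun n : ℕ => (a.seq n).angle (b.seq n)

/-- Representatives `(a, t)` of points of the tangent cone at `p`, that is, of the Euclidean cone
over the space of directions. The tangent cone itself is the metric space obtained by identifying
points whose distance `TangentCone.coneDist` vanishes. -/
structure TangentCone (p : X) where
  dir : SpaceOfDirections p
  radius : ℝ≥0

/-- The distance on the tangent cone. -/
def TangentCone.coneDist {p : X} (a b : TangentCone p) : ℝ :=
  Real.sqrt ((a.radius : ℝ) ^ 2 + (b.radius : ℝ) ^ 2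
    - 2 * a.radius * b.radius * Real.cos (a.dir.angle b.dir))

end HilbertHadamard


/-- The tangent cone at `p` embeds isometrically into a real Hilbert space. (A distance preserving
map on representatives automatically identifies representatives of the same point.) -/
def TangentConeEmbeds {X : Type v} [MetricSpace X] (p : X) : Prop :=
  ∃ (H : Type v) (_ : NormedAddCommGroup H) (_ : InnerProductSpace ℝ H) (_ : CompleteSpace H)
    (f : TangentCone p → H), ∀ a b : TangentCone p, dist (f a) (f b) = a.coneDist b

/-- A Hilbert--Hadamard space: a (nonempty) complete geodesic CAT(0) space all of whose tangent
cones embed isometrically into Hilbert spaces. -/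
structure IsHilbertHadamard (X : Type v) [MetricSpace X] : Prop where
  nonempty : Nonempty X
  complete : CompleteSpace X
  geodesic : IsGeodesicSpace X
  cat0 : IsCAT0 X
  tangentCone : ∀ p : X, TangentConeEmbeds p

/-! ### Continuous fields of Hilbert--Hadamard spaces -/

/-- A set of sections is mutually co-continuous if the pointwise distance between any two of its
elements is continuous. -/
def MutuallyCocontinuous {Z : Type u} [TopologicalSpace Z] {F : Z → Type v}
    [∀ z, MetricSpace (F z)] (S : Set (∀ z, F z)) : Prop :=
  ∀ s ∈ S, ∀ s' ∈ S, Continuous fun z => dist (s z) (s' z)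

/-- The set of sections generated by `S`: all `s` such that `S ∪ {s}` is mutually
co-continuous. -/
def generatedSections {Z : Type u} [TopologicalSpace Z] {F : Z → Type v}
    [∀ z, MetricSpace (F z)] (S : Set (∀ z, F z)) : Set (∀ z, F z) :=
  {s | MutuallyCocontinuous (insert s S)}

/-- The data underlying a continuous field over `Z`: metric spaces indexed by `Z` together with a
set of sections. The conditions are in `MetricField.IsContinuousField`. -/
structure MetricField (Z : Type u) where
  fiber : Z → Type v
  [metric : ∀ z, MetricSpace (fiber z)]
  cont : Set (∀ z, fiber z)

attribute [instance] MetricField.metric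

namespace MetricField

variable {Z : Type u} [TopologicalSpace Z]

/-- `C` is a continuous field of Hilbert--Hadamard spaces over the locally compact paracompact
Hausdorff space `Z`. -/
structure IsContinuousField (C : MetricField.{u, v} Z) : Prop where
  locallyCompact : LocallyCompactSpace Z
  paracompact : ParacompactSpace Z
  hausdorff : T2Space Z
  fiber_hilbertHadamard : ∀ z, IsHilbertHadamard (C.fiber z)
  convex : ∀ s₁ ∈ C.cont, ∀ s₂ ∈ C.cont, ∀ s₀ : ∀ z, C.fiber z,
    (∀ z, IsMidpoint (s₀ z) (s₁ z) (s₂ z)) → s₀ ∈ C.cont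
  dense : ∀ z, Dense ((fun s : ∀ z, C.fiber z => s z) '' C.cont)
  cocontinuous : MutuallyCocontinuous C.cont
  closed : ∀ s : ∀ z, C.fiber z, MutuallyCocontinuous (insert s C.cont) → s ∈ C.cont

/-- The constant field over `Z` with fiber `X`; its sections are the continuous maps. -/
def const (Z : Type u) [TopologicalSpace Z] (X : Type v) [MetricSpace X] :
    MetricField.{u, v} Z where
  fiber _ := X
  cont := {s | Continuous s}

/-- The field over `Y` induced from `C` by a map `f : Y → Z`: the fiber at `y` is the fiber of `C`
at `f y`, and the sections are generated by the `s ∘ f` for `s` a section of `C`. -/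
def pullback (C : MetricField.{u, v} Z) {Y : Type w} [TopologicalSpace Y] (f : Y → Z) :
    MetricField.{w, v} Y where
  fiber y := C.fiber (f y)
  cont := generatedSections ((fun (s : ∀ z, C.fiber z) (y : Y) => s (f y)) '' C.cont)

/-- The reduction of `C` to a subspace of the base space. -/
def restrict (C : MetricField.{u, v} Z) (U : Set Z) : MetricField.{u, v} U :=
  C.pullback (Subtype.val : U → Z)

/-- Second countability: of the base space and of all fibers. -/
def IsSecondCountable (C : MetricField.{u, v} Z) : Prop :=
  SecondCountableTopology Z ∧ ∀ z, SecondCountableTopology (C.fiber z)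

/-- Isometric continuous morphisms `C → D`; they are contravariant on base spaces. -/
@[ext]
structure Morphism {Y : Type u'} [TopologicalSpace Y]
    (C : MetricField.{u, v} Z) (D : MetricField.{u', v'} Y) where
  base : Y → Z
  map : ∀ y, C.fiber (base y) → D.fiber y
  continuous_base : Continuous base
  isometry_map : ∀ y, Isometry (map y)
  map_cont : ∀ s ∈ C.cont, (fun y => map y (s (base y))) ∈ D.cont

/-- The identity morphism. -/
def Morphism.id (C : MetricField.{u, v} Z) : Morphism C C where
  base z := z
  map _ x := x
  continuous_base := continuous_id
  isometry_map _ := isometry_id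
  map_cont _ hs := hs

/-- The composition `ψ ∘ φ`. -/
def Morphism.comp {Y : Type u'} [TopologicalSpace Y] {W : Type u''} [TopologicalSpace W]
    {C : MetricField.{u, v} Z} {D : MetricField.{u', v'} Y} {E : MetricField.{u'', v''} W}
    (ψ : Morphism D E) (φ : Morphism C D) : Morphism C E where
  base w := φ.base (ψ.base w)
  map w x := ψ.map w (φ.map (ψ.base w) x)
  continuous_base := φ.continuous_base.comp ψ.continuous_base
  isometry_map w := (ψ.isometry_map w).comp (φ.isometry_map (ψ.base w))
  map_cont s hs := ψ.map_cont _ (φ.map_cont s hs)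

/-- Two fields are isometrically continuously isomorphic. -/
def Isomorphic {Y : Type u'} [TopologicalSpace Y]
    (C : MetricField.{u, v} Z) (D : MetricField.{u', v'} Y) : Prop :=
  ∃ (φ : Morphism C D) (ψ : Morphism D C), ψ.comp φ = Morphism.id C ∧ φ.comp ψ = Morphism.id D

/-- A field is trivial if it is isomorphic to a constant field of Hilbert--Hadamard spaces. -/
def IsTrivial (C : MetricField.{u, v} Z) : Prop :=
  ∃ (X : Type v) (_ : MetricSpace X), IsHilbertHadamard X ∧ Isomorphic C (const Z X)

/-- A field is locally trivial if every point of the base space has an open neighborhood over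
which the field is trivial. -/
def IsLocallyTrivial (C : MetricField.{u, v} Z) : Prop :=
  ∀ z : Z, ∃ U : Set Z, IsOpen U ∧ z ∈ U ∧ (C.restrict U).IsTrivial

/-- All fibers are isometric to one and the same Hilbert--Hadamard space. -/
def HasIsometricFibers (C : MetricField.{u, v} Z) : Prop :=
  ∃ (X : Type v) (_ : MetricSpace X), IsHilbertHadamard X ∧ ∀ z, Nonempty (C.fiber z ≃ᵢ X)

end MetricField

/-! ### Continuum products and randomizations -/

/-- The `L²`-continuum product `L²(Y, μ, X)`: almost everywhere classes of (strongly) measurable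
maps `ξ : Y → X` such that `d(ξ(y), x₀)` is square integrable. For separable `X` strong
measurability is measurability, and for finite `μ` the choice of `x₀` does not matter. -/
def ContinuumProduct {Y : Type w} [MeasurableSpace Y] (μ : Measure Y)
    (X : Type v) [MetricSpace X] : Type (max w v) :=
  {ξ : Y →ₘ[μ] X // ∃ x₀ : X, ∫⁻ y, edist (ξ y) x₀ ^ 2 ∂μ < ∞}

namespace ContinuumProduct

variable {Y : Type w} [MeasurableSpace Y] {μ : Measure Y} {X : Type v} [MetricSpace X]

theorem aestronglyMeasurable_dist (ξ η : ContinuumProduct μ X) :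
    AEStronglyMeasurable (fun y => dist (ξ.1 y) (η.1 y)) μ :=
  ξ.1.aestronglyMeasurable.dist η.1.aestronglyMeasurable

theorem memLp_dist_const (ξ : Y →ₘ[μ] X) (x₀ : X) (h : ∫⁻ y, edist (ξ y) x₀ ^ 2 ∂μ < ∞) :
    MemLp (fun y => dist (ξ y) x₀) 2 μ := by
  refine ⟨ξ.aestronglyMeasurable.dist aestronglyMeasurable_const, ?_⟩
  rw [eLpNorm_lt_top_iff_lintegral_rpow_enorm_lt_top (by norm_num) (by norm_num)]
  refine lt_of_le_of_lt (le_of_eq ?_) h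
  refine lintegral_congr fun y => ?_
  have : ‖dist (ξ y) x₀‖ₑ = edist (ξ y) x₀ := by
    rw [Real.enorm_eq_ofReal dist_nonneg, edist_dist]
  rw [this]
  norm_num

theorem memLp_dist [IsFiniteMeasure μ] (ξ η : ContinuumProduct μ X) :
    MemLp (fun y => dist (ξ.1 y) (η.1 y)) 2 μ := by
  obtain ⟨x, hx⟩ := ξ.2
  obtain ⟨x', hx'⟩ := η.2
  have h := ((memLp_dist_const ξ.1 x hx).add (memLp_const (dist x x'))).add
    (memLp_dist_const η.1 x' hx')
  refine h.mono (aestronglyMeasurable_dist ξ η) (Eventually.of_forall fun y => ?_)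
  simp only [Pi.add_apply, Real.norm_eq_abs]
  rw [abs_of_nonneg dist_nonneg, abs_of_nonneg (by positivity)]
  have := dist_triangle4 (ξ.1 y) x x' (η.1 y)
  rwa [dist_comm x' (η.1 y)] at this

/-- The distance `(∫ d(ξ(y), η(y))² dμ(y))^{1/2}`. -/
instance : Dist (ContinuumProduct μ X) where
  dist ξ η := Real.sqrt (∫ y, dist (ξ.1 y) (η.1 y) ^ 2 ∂μ)

theorem dist_def (ξ η : ContinuumProduct μ X) :
    dist ξ η = Real.sqrt (∫ y, dist (ξ.1 y) (η.1 y) ^ 2 ∂μ) := rfl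

theorem dist_eq_eLpNorm [IsFiniteMeasure μ] (ξ η : ContinuumProduct μ X) :
    dist ξ η = (eLpNorm (fun y => dist (ξ.1 y) (η.1 y)) 2 μ).toReal := by
  rw [dist_def, (memLp_dist ξ η).eLpNorm_eq_integral_rpow_norm (by norm_num) (by norm_num),
    ENNReal.toReal_ofReal (by positivity), Real.sqrt_eq_rpow]
  norm_num

instance [IsFiniteMeasure μ] : MetricSpace (ContinuumProduct μ X) where
  dist_self ξ := by simp [dist_def]
  dist_comm ξ η := by simp only [dist_def, dist_comm]
  dist_triangle ξ η ζ := by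
    rw [dist_eq_eLpNorm, dist_eq_eLpNorm, dist_eq_eLpNorm,
      ← ENNReal.toReal_add (memLp_dist ξ η).eLpNorm_ne_top (memLp_dist η ζ).eLpNorm_ne_top]
    refine ENNReal.toReal_mono
      (ENNReal.add_ne_top.2 ⟨(memLp_dist ξ η).eLpNorm_ne_top, (memLp_dist η ζ).eLpNorm_ne_top⟩) ?_
    refine le_trans (eLpNorm_mono_real fun y => ?_)
      (eLpNorm_add_le (aestronglyMeasurable_dist ξ η) (aestronglyMeasurable_dist η ζ) (by norm_num))
    rw [Real.norm_eq_abs, abs_of_nonneg dist_nonneg]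
    exact dist_triangle _ _ _
  eq_of_dist_eq_zero {ξ η} h := by
    rw [dist_eq_eLpNorm, ENNReal.toReal_eq_zero_iff] at h
    have h' := h.resolve_right (memLp_dist ξ η).eLpNorm_ne_top
    rw [eLpNorm_eq_zero_iff (aestronglyMeasurable_dist ξ η) (by norm_num)] at h'
    refine Subtype.ext (AEEqFun.ext ?_)
    filter_upwards [h'] with y hy
    exact dist_eq_zero.1 hy

end ContinuumProduct

namespace MetricField

variable {Z : Type u} [TopologicalSpace Z]

/-- The `L²`-continuum power of `C` by `(Y, μ)`; for `(Y, μ)` a standard probability space it is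
the randomization of `C`. The fiber at `z` is `L²(Y, μ, C_z)`; this is the `L²`-continuum product
of the extension of `C` over `Z × Y` with respect to the measure `δ_z × μ`, which is carried by
`{z} × Y`. The continuous sections are generated by the sections `z ↦ [s(z, ·)]` for `s` a
continuous section of the extension of `C` over `Z × Y`. -/
def continuumPower (C : MetricField.{u, v} Z) {Y : Type w} [TopologicalSpace Y]
    [MeasurableSpace Y] (μ : Measure Y) [IsFiniteMeasure μ] : MetricField.{u, max w v} Z where
  fiber z := ContinuumProduct μ (C.fiber z)
  cont := generatedSections
    {σ : ∀ z, ContinuumProduct μ (C.fiber z) |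
      ∃ s ∈ (C.pullback (Prod.fst : Z × Y → Z)).cont, ∀ z, (σ z).1 =ᵐ[μ] fun y => s (z, y)}

/-- `C` is randomization-stable (with respect to the standard probability space `(Ω, μ)`): it is
second-countable and isometrically continuously isomorphic to its randomization. -/
def IsRandomizationStable (C : MetricField.{u, v} Z) {Ω : Type w} [TopologicalSpace Ω]
    [MeasurableSpace Ω] (μ : Measure Ω) [IsFiniteMeasure μ] : Prop :=
  C.IsSecondCountable ∧ Isomorphic C (C.continuumPower μ)

end MetricField

end

/-!
# Randomization trivializes locally trivial continuous fields

Let `C` be a second-countable locally trivial field all of whose fibers are isometric to `X`. The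
randomization of `C` is trivialized by choosing the local trivialization at random. Cover the base
space by countably many trivializing open sets `U n` with charts `e n z : C_z ≃ᵢ X` and take bump
functions `f n`, supported in `U n`, such that near every point some `f n` is equal to `1`
(`MetricField.BumpAtlas`). Let `r : Ω → [0,1)` be a random number without atoms. Over `z`, the
outcome `ω` selects the chart with the least index `n` such that `r ω < f n z`; applying the
selected charts pointwise gives a bijective isometry from `L²(Ω, μ, C_z)` onto `L²(Ω, μ, X)`. As `z`
varies, the selection changes only on a set of small measure since `r` has no atoms, so these
isometries carry continuous sections to continuous maps, by dominated convergence
(`MetricField.BumpAtlas.continuous_randomChart`). The sections that come from continuous sections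
over `Z × Ω` take dense sets of values in the fibers (`MetricField.BumpAtlas.dense_sections`): a
simple function is approximated by mixing sections along geodesics with Urysohn functions on `Ω`.
A family of fiberwise isometries that is continuous on such a dense set of sections identifies all
generated sections with the continuous maps (`MetricField.mem_generatedSections_iff`). Hence the
randomization is isomorphic to the constant field with fiber `L²(Ω, μ, X)`
(`MetricField.isomorphic_continuumPower_const`). If `C` is randomization-stable, then comparing the
fibers of `C` and of this constant field shows that `L²(Ω, μ, X)` is isometric to `X`, and `C` is
trivial.

It remains to see that `L²(Ω, μ, X)` is a Hilbert--Hadamard space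
(`ContinuumProduct.isHilbertHadamard`). Geodesics in it are pointwise geodesics, and the CAT(0)
inequality is obtained by integration. For the tangent cones, a geodesic CAT(0) space has at every
point an inner product of initial velocities of geodesics, the limit of Euclidean comparison inner
products, and the tangent cone embeds into a Hilbert space exactly if this kernel is positive
semidefinite (`tangentConeEmbeds_iff`). The kernel of `L²(Ω, μ, X)` is the integral of the kernels
of `X` (`ContinuumProduct.tangentInner_eq_integral`), and integration preserves positivity.
-/

/-! ### Geodesics in CAT(0) spaces -/

section CAT0

variable {X : Type*} [MetricSpace X]

theorem IsGeodesicSegment.dist_zero_left {γ : ℝ → X} {ℓ : ℝ} (hγ : IsGeodesicSegment γ ℓ) {t : ℝ}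
    (ht : t ∈ Icc (0 : ℝ) 1) : dist (γ 0) (γ t) = t * ℓ := by
  rw [hγ 0 (by simp) t ht, zero_sub, abs_neg, abs_of_nonneg ht.1]

theorem IsGeodesicSegment.dist_one_right {γ : ℝ → X} {ℓ : ℝ} (hγ : IsGeodesicSegment γ ℓ) {t : ℝ}
    (ht : t ∈ Icc (0 : ℝ) 1) : dist (γ t) (γ 1) = (1 - t) * ℓ := by
  rw [hγ t ht 1 (by simp), abs_sub_comm, abs_of_nonneg (by linarith [ht.2])]

theorem IsGeodesicSegment.dist_zero_one {γ : ℝ → X} {ℓ : ℝ} (hγ : IsGeodesicSegment γ ℓ) :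
    dist (γ 0) (γ 1) = ℓ := by
  rw [hγ.dist_zero_left (by simp), one_mul]

theorem IsGeodesicSegment.continuousOn {γ : ℝ → X} {ℓ : ℝ} (hγ : IsGeodesicSegment γ ℓ) :
    ContinuousOn γ (Icc 0 1) := by
  have hℓ : 0 ≤ ℓ := hγ.dist_zero_one ▸ dist_nonneg
  refine LipschitzOnWith.continuousOn (K := ℓ.toNNReal) (LipschitzOnWith.of_dist_le_mul ?_)
  intro s hs t ht
  rw [hγ s hs t ht, Real.coe_toNNReal ℓ hℓ, Real.dist_eq, mul_comm]

/-- A continuous midpoint-convex function on `[0,1]` that vanishes at the endpoints is nonpositive: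
at a positive maximum, the midpoint inequality for the reflection of the nearer endpoint fails. -/
theorem nonpos_of_midpoint_convex {g : ℝ → ℝ} (hc : ContinuousOn g (Icc 0 1)) (h0 : g 0 = 0)
    (h1 : g 1 = 0)
    (hm : ∀ a ∈ Icc (0 : ℝ) 1, ∀ b ∈ Icc (0 : ℝ) 1, g ((a + b) / 2) ≤ (g a + g b) / 2)
    {t : ℝ} (ht : t ∈ Icc (0 : ℝ) 1) : g t ≤ 0 := by
  obtain ⟨x, hx, hmax⟩ := isCompact_Icc.exists_isMaxOn ⟨t, ht⟩ hc
  refine (hmax ht).trans ?_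
  rcases le_total x (1 / 2) with h | h
  · have hb : 2 * x ∈ Icc (0 : ℝ) 1 := ⟨by linarith [hx.1], by linarith⟩
    have h2 := hm 0 (by simp) (2 * x) hb
    have h3 : g (2 * x) ≤ g x := hmax hb
    rw [show (0 + 2 * x) / 2 = x by ring, h0] at h2
    linarith
  · have hb : 2 * x - 1 ∈ Icc (0 : ℝ) 1 := ⟨by linarith, by linarith [hx.2]⟩
    have h2 := hm (2 * x - 1) hb 1 (by simp)
    have h3 : g (2 * x - 1) ≤ g x := hmax hb
    rw [show (2 * x - 1 + 1) / 2 = x by ring, h1] at h2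
    linarith

/-- The CN inequality at an arbitrary point of a geodesic segment. -/
theorem IsCAT0.dist_sq_le (hX : IsCAT0 X) {γ : ℝ → X} {ℓ : ℝ} (hγ : IsGeodesicSegment γ ℓ) (p : X)
    {t : ℝ} (ht : t ∈ Icc (0 : ℝ) 1) :
    dist p (γ t) ^ 2 ≤
      (1 - t) * dist p (γ 0) ^ 2 + t * dist p (γ 1) ^ 2 - t * (1 - t) * ℓ ^ 2 := by
  have key := nonpos_of_midpoint_convex
    (g := fun t => dist p (γ t) ^ 2 -
      ((1 - t) * dist p (γ 0) ^ 2 + t * dist p (γ 1) ^ 2 - t * (1 - t) * ℓ ^ 2))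
    ((ContinuousOn.pow (fun t ht => tendsto_const_nhds.dist (hγ.continuousOn t ht)) 2).sub
      (by fun_prop)) (by simp) (by simp)
    (fun a ha b hb => ?_) ht
  · linarith
  · have hab : (a + b) / 2 ∈ Icc (0 : ℝ) 1 :=
      ⟨by linarith [ha.1, hb.1], by linarith [ha.2, hb.2]⟩
    have hmid : IsMidpoint (γ ((a + b) / 2)) (γ a) (γ b) := by
      constructor
      · rw [hγ a ha _ hab, hγ a ha b hb, show a - (a + b) / 2 = (a - b) / 2 by ring, abs_div,
          abs_of_pos (two_pos : (0 : ℝ) < 2)]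
        ring
      · rw [hγ b hb _ hab, hγ a ha b hb, show b - (a + b) / 2 = -((a - b) / 2) by ring, abs_neg,
          abs_div, abs_of_pos (two_pos : (0 : ℝ) < 2)]
        ring
    have h := hX p _ _ _ hmid
    rw [dist_comm _ p, hγ a ha b hb, mul_pow, sq_abs] at h
    linear_combination h / 2

/-- A chosen geodesic segment from `x` to `y`, parametrized by `[0,1]`; its values outside `[0,1]`
are irrelevant. In a CAT(0) space it is unique, see `IsGeodesicSpace.eq_geo`. -/
noncomputable def IsGeodesicSpace.geo (hg : IsGeodesicSpace X) (x y : X) : ℝ → X := (hg x y).choose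

namespace IsGeodesicSpace

variable (hg : IsGeodesicSpace X)

@[simp] theorem geo_zero (x y : X) : hg.geo x y 0 = x := (hg x y).choose_spec.1

@[simp] theorem geo_one (x y : X) : hg.geo x y 1 = y := (hg x y).choose_spec.2.1

theorem isGeodesicSegment_geo (x y : X) : IsGeodesicSegment (hg.geo x y) (dist x y) :=
  (hg x y).choose_spec.2.2

theorem dist_left_geo (x y : X) {t : ℝ} (ht : t ∈ Icc (0 : ℝ) 1) :
    dist x (hg.geo x y t) = t * dist x y := by
  simpa using (hg.isGeodesicSegment_geo x y).dist_zero_left ht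

theorem dist_geo_right (x y : X) {t : ℝ} (ht : t ∈ Icc (0 : ℝ) 1) :
    dist (hg.geo x y t) y = (1 - t) * dist x y := by
  simpa using (hg.isGeodesicSegment_geo x y).dist_one_right ht

variable {hg}

theorem dist_geo_sq_le (hX : IsCAT0 X) (p x y : X) {t : ℝ} (ht : t ∈ Icc (0 : ℝ) 1) :
    dist p (hg.geo x y t) ^ 2 ≤
      (1 - t) * dist p x ^ 2 + t * dist p y ^ 2 - t * (1 - t) * dist x y ^ 2 := by
  simpa using hX.dist_sq_le (hg.isGeodesicSegment_geo x y) p ht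

theorem eq_geo_of_dist (hX : IsCAT0 X) {x y m : X} {t : ℝ} (ht : t ∈ Icc (0 : ℝ) 1)
    (h₁ : dist x m = t * dist x y) (h₂ : dist m y = (1 - t) * dist x y) : m = hg.geo x y t := by
  have h := dist_geo_sq_le (hg := hg) hX m x y ht
  rw [dist_comm m x, h₁, h₂] at h
  have : dist m (hg.geo x y t) ^ 2 ≤ 0 := by linarith
  exact dist_eq_zero.1 (pow_eq_zero_iff two_ne_zero |>.1 (le_antisymm this (sq_nonneg _)))

/-- Geodesic segments in CAT(0) spaces are determined by their endpoints. -/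
theorem eq_geo (hX : IsCAT0 X) {γ : ℝ → X} {ℓ : ℝ} (hγ : IsGeodesicSegment γ ℓ) {t : ℝ}
    (ht : t ∈ Icc (0 : ℝ) 1) : γ t = hg.geo (γ 0) (γ 1) t :=
  eq_geo_of_dist hX ht (by rw [hγ.dist_zero_left ht, hγ.dist_zero_one])
    (by rw [hγ.dist_one_right ht, hγ.dist_zero_one])

/-- In a CAT(0) space, the geodesic from `x` to `y` depends jointly continuously on its endpoints
and the parameter. -/
theorem tendsto_geo (hX : IsCAT0 X) {W : Type*} {l : Filter W} {f g : W → X} {τ : W → ℝ} {x y : X}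
    {t : ℝ} (hf : Tendsto f l (𝓝 x)) (hg' : Tendsto g l (𝓝 y)) (hτ : Tendsto τ l (𝓝 t))
    (hτ01 : ∀ᶠ w in l, τ w ∈ Icc (0 : ℝ) 1) (ht : t ∈ Icc (0 : ℝ) 1) :
    Tendsto (fun w => hg.geo (f w) (g w) (τ w)) l (𝓝 (hg.geo x y t)) := by
  rw [tendsto_iff_dist_tendsto_zero]
  have hsq : Tendsto (fun w => dist (hg.geo (f w) (g w) (τ w)) (hg.geo x y t) ^ 2) l (𝓝 0) := by
    have hfx : Tendsto (fun w => dist (f w) x) l (𝓝 0) := tendsto_iff_dist_tendsto_zero.1 hf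
    have hgy : Tendsto (fun w => dist (g w) y) l (𝓝 0) := tendsto_iff_dist_tendsto_zero.1 hg'
    have hd : Tendsto (fun w => dist (f w) (g w)) l (𝓝 (dist x y)) := hf.dist hg'
    have hlim : Tendsto (fun w => (1 - t) * (τ w * dist (f w) (g w) + dist (f w) x) ^ 2 +
        t * ((1 - τ w) * dist (f w) (g w) + dist (g w) y) ^ 2 - t * (1 - t) * dist x y ^ 2)
        l (𝓝 0) := by
      have := ((((hτ.mul hd).add hfx).pow 2).const_mul (1 - t)).add
        ((((((tendsto_const_nhds (x := (1 : ℝ))).sub hτ).mul hd).add hgy).pow 2).const_mul t)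
        |>.sub (tendsto_const_nhds (x := t * (1 - t) * dist x y ^ 2))
      convert this using 2
      ring
    refine tendsto_of_tendsto_of_tendsto_of_le_of_le' tendsto_const_nhds hlim
      (Eventually.of_forall fun w => sq_nonneg _) ?_
    filter_upwards [hτ01] with w hw
    refine (dist_geo_sq_le hX _ x y ht).trans ?_
    have h1 : dist (hg.geo (f w) (g w) (τ w)) x ≤ τ w * dist (f w) (g w) + dist (f w) x := by
      rw [← hg.dist_left_geo (f w) (g w) hw, dist_comm (f w) (hg.geo _ _ _)]
      exact dist_triangle _ _ _
    have h2 : dist (hg.geo (f w) (g w) (τ w)) y ≤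
        (1 - τ w) * dist (f w) (g w) + dist (g w) y := by
      rw [← hg.dist_geo_right (f w) (g w) hw]
      exact dist_triangle _ _ _
    have h1t : 0 ≤ 1 - t := by linarith [ht.2]
    have h0t := ht.1
    gcongr
  have := hsq.sqrt
  simpa [Real.sqrt_sq dist_nonneg] using this

theorem continuous_geo (hX : IsCAT0 X) {W : Type*} [TopologicalSpace W] {f g : W → X} {τ : W → ℝ}
    (hf : Continuous f) (hg' : Continuous g) (hτ : Continuous τ)
    (hτ01 : ∀ w, τ w ∈ Icc (0 : ℝ) 1) : Continuous fun w => hg.geo (f w) (g w) (τ w) :=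
  continuous_iff_continuousAt.2 fun w => tendsto_geo hX hf.continuousAt hg'.continuousAt
    hτ.continuousAt (Eventually.of_forall hτ01) (hτ01 w)

end IsGeodesicSpace

/-! ### Inner products on tangent cones -/

namespace IsGeodesicSpace

variable (hg : IsGeodesicSpace X)

/-- The Euclidean comparison inner product of the points at parameters `s` and `t` on the geodesics
from `p` to `x` and to `y`, rescaled to the unit parameter. -/
noncomputable def comparisonInner (p x y : X) (s t : ℝ) : ℝ :=
  (dist p (hg.geo p x s) ^ 2 + dist p (hg.geo p y t) ^ 2
    - dist (hg.geo p x s) (hg.geo p y t) ^ 2) / (2 * s * t)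

/-- The inner product, in the tangent cone at `p`, of the initial velocities of the geodesics from
`p` to `x` and to `y`. -/
noncomputable def tangentInner (p x y : X) : ℝ :=
  limUnder (𝓝[>] (0 : ℝ) ×ˢ 𝓝[>] (0 : ℝ)) fun q : ℝ × ℝ => hg.comparisonInner p x y q.1 q.2

theorem comparisonInner_comm (p x y : X) (s t : ℝ) :
    hg.comparisonInner p x y s t = hg.comparisonInner p y x t s := by
  unfold comparisonInner
  rw [dist_comm (hg.geo p x s)]
  ring

theorem comparisonInner_eq (p x y : X) {s t : ℝ} (hs : s ∈ Icc (0 : ℝ) 1) (ht : t ∈ Icc (0 : ℝ) 1) :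
    hg.comparisonInner p x y s t = ((s * dist p x) ^ 2 + (t * dist p y) ^ 2
      - dist (hg.geo p x s) (hg.geo p y t) ^ 2) / (2 * s * t) := by
  rw [comparisonInner, hg.dist_left_geo p x hs, hg.dist_left_geo p y ht]

/-- The Cauchy--Schwarz inequality for comparison inner products, which is the triangle inequality
for the triangle with vertices `p`, `geo p x s` and `geo p y t`. -/
theorem abs_comparisonInner_le (p x y : X) {s t : ℝ} (hs : s ∈ Ioc (0 : ℝ) 1)
    (ht : t ∈ Ioc (0 : ℝ) 1) : |hg.comparisonInner p x y s t| ≤ dist p x * dist p y := by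
  have hs' := Ioc_subset_Icc_self hs
  have ht' := Ioc_subset_Icc_self ht
  have hst : 0 < 2 * s * t := by have := hs.1; have := ht.1; positivity
  rw [hg.comparisonInner_eq p x y hs' ht', abs_div, abs_of_pos hst, div_le_iff₀ hst]
  have h1 := dist_triangle_left (hg.geo p x s) (hg.geo p y t) p
  have h2 := dist_triangle p (hg.geo p x s) (hg.geo p y t)
  have h3 := dist_triangle_right p (hg.geo p x s) (hg.geo p y t)
  rw [hg.dist_left_geo p x hs', hg.dist_left_geo p y ht'] at h1 h2 h3
  have h4 : 0 ≤ dist (hg.geo p x s) (hg.geo p y t) := dist_nonneg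
  set a := s * dist p x
  set b := t * dist p y
  set c := dist (hg.geo p x s) (hg.geo p y t)
  have : dist p x * dist p y * (2 * s * t) = 2 * a * b := by simp only [a, b]; ring
  rw [this, abs_le]
  have ha : 0 ≤ a := mul_nonneg hs.1.le dist_nonneg
  have hb : 0 ≤ b := mul_nonneg ht.1.le dist_nonneg
  constructor
  · nlinarith
  · have : |a - b| ≤ |c| := by rw [abs_of_nonneg h4, abs_le]; constructor <;> linarith
    nlinarith [sq_le_sq.2 this]

variable {hg}

/-- Comparison angles grow with the side lengths, so comparison inner products decrease: this is the
CN inequality at the point `geo p x s'` of the geodesic from `p` to `geo p x s`. -/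
theorem comparisonInner_antitone_left (hX : IsCAT0 X) (p x y : X) {s s' t : ℝ} (hs' : 0 < s')
    (hss : s' ≤ s) (hs : s ≤ 1) (ht : 0 < t) :
    hg.comparisonInner p x y s t ≤ hg.comparisonInner p x y s' t := by
  have hs0 : 0 < s := hs'.trans_le hss
  have hl : s' / s ∈ Icc (0 : ℝ) 1 := ⟨by positivity, (div_le_one hs0).2 hss⟩
  have hsI : s ∈ Icc (0 : ℝ) 1 := ⟨hs0.le, hs⟩
  have hs'I : s' ∈ Icc (0 : ℝ) 1 := ⟨hs'.le, hss.trans hs⟩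
  have hgeo : hg.geo p x s' = hg.geo p (hg.geo p x s) (s' / s) := by
    refine eq_geo_of_dist hX hl ?_ ?_
    · rw [hg.dist_left_geo p x hs'I, hg.dist_left_geo p x hsI]
      field_simp
    · rw [hg.isGeodesicSegment_geo p x s' hs'I s hsI, hg.dist_left_geo p x hsI, abs_sub_comm,
        abs_of_nonneg (by linarith)]
      field_simp
  have h := dist_geo_sq_le (hg := hg) hX (hg.geo p y t) p (hg.geo p x s) hl
  rw [← hgeo, dist_comm (hg.geo p y t) (hg.geo p x s'), dist_comm (hg.geo p y t) (hg.geo p x s),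
    dist_comm (hg.geo p y t) p] at h
  have h2 : dist p (hg.geo p x s') = s' / s * dist p (hg.geo p x s) := by
    rw [hg.dist_left_geo p x hs'I, hg.dist_left_geo p x hsI]
    field_simp
  unfold comparisonInner
  rw [h2]
  set l := s' / s with hl'
  have hls : s' = l * s := by rw [hl']; field_simp
  have hl0 : 0 < l := by positivity
  rw [hls, show 2 * (l * s) * t = l * (2 * s * t) by ring,
    show ∀ a b : ℝ, a / (l * b) = a / l / b by intro a b; rw [div_div]]
  gcongr
  rw [le_div_iff₀ hl0]
  rw [hls] at h
  linear_combination h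

theorem comparisonInner_antitone (hX : IsCAT0 X) (p x y : X) {s s' t t' : ℝ} (hs' : 0 < s')
    (hss : s' ≤ s) (hs : s ≤ 1) (ht' : 0 < t') (htt : t' ≤ t) (ht : t ≤ 1) :
    hg.comparisonInner p x y s t ≤ hg.comparisonInner p x y s' t' := by
  refine (comparisonInner_antitone_left hX p x y hs' hss hs (ht'.trans_le htt)).trans ?_
  rw [comparisonInner_comm, hg.comparisonInner_comm p x y s' t']
  exact comparisonInner_antitone_left hX p y x ht' htt ht hs'

theorem eventually_mem_Ioc_nhdsGT_prod {a b : ℝ} (ha : 0 < a) (hb : 0 < b) :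
    ∀ᶠ q : ℝ × ℝ in 𝓝[>] (0 : ℝ) ×ˢ 𝓝[>] (0 : ℝ), q.1 ∈ Ioc 0 a ∧ q.2 ∈ Ioc 0 b :=
  prod_mem_prod (Ioc_mem_nhdsGT ha) (Ioc_mem_nhdsGT hb)

/-- The limit defining `tangentInner` exists, by monotonicity of comparison angles in CAT(0)
spaces. -/
theorem tendsto_comparisonInner (hX : IsCAT0 X) (p x y : X) :
    Tendsto (fun q : ℝ × ℝ => hg.comparisonInner p x y q.1 q.2)
      (𝓝[>] (0 : ℝ) ×ˢ 𝓝[>] (0 : ℝ)) (𝓝 (hg.tangentInner p x y)) := by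
  refine tendsto_nhds_limUnder ?_
  set S : Set ℝ := (fun q : ℝ × ℝ => hg.comparisonInner p x y q.1 q.2) '' (Ioc 0 1 ×ˢ Ioc 0 1)
  have hne : S.Nonempty := ⟨_, mem_image_of_mem _ (⟨⟨one_pos, le_rfl⟩, ⟨one_pos, le_rfl⟩⟩ :
    ((1 : ℝ), (1 : ℝ)) ∈ Ioc (0 : ℝ) 1 ×ˢ Ioc (0 : ℝ) 1)⟩
  have hbdd : BddAbove S := by
    refine ⟨dist p x * dist p y, ?_⟩
    rintro _ ⟨q, hq, rfl⟩
    exact (le_abs_self _).trans (hg.abs_comparisonInner_le p x y hq.1 hq.2)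
  refine ⟨sSup S, tendsto_order.2 ⟨fun a ha => ?_, fun a ha => ?_⟩⟩
  · obtain ⟨_, ⟨q, hq, rfl⟩, hlt⟩ := exists_lt_of_lt_csSup hne ha
    filter_upwards [eventually_mem_Ioc_nhdsGT_prod hq.1.1 hq.2.1] with r hr
    exact hlt.trans_le (comparisonInner_antitone hX p x y hr.1.1 hr.1.2 hq.1.2 hr.2.1 hr.2.2
      hq.2.2)
  · filter_upwards [eventually_mem_Ioc_nhdsGT_prod one_pos one_pos] with r hr
    exact (le_csSup hbdd ⟨r, ⟨hr.1, hr.2⟩, rfl⟩).trans_lt ha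

theorem abs_tangentInner_le (hX : IsCAT0 X) (p x y : X) :
    |hg.tangentInner p x y| ≤ dist p x * dist p y := by
  refine le_of_tendsto (tendsto_comparisonInner hX p x y).abs ?_
  filter_upwards [eventually_mem_Ioc_nhdsGT_prod one_pos one_pos] with r hr
  exact hg.abs_comparisonInner_le p x y hr.1 hr.2

theorem tangentInner_comm (hX : IsCAT0 X) (p x y : X) :
    hg.tangentInner p x y = hg.tangentInner p y x := by
  refine tendsto_nhds_unique (tendsto_comparisonInner hX p x y)
    (((tendsto_comparisonInner (hg := hg) hX p y x).comp tendsto_prod_swap).congr fun q => ?_)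
  exact (hg.comparisonInner_comm p x y q.1 q.2).symm

theorem tangentInner_self (hX : IsCAT0 X) (p x : X) :
    hg.tangentInner p x x = dist p x ^ 2 := by
  refine tendsto_nhds_unique (tendsto_comparisonInner hX p x x)
    (tendsto_const_nhds.congr' ?_)
  filter_upwards [eventually_mem_Ioc_nhdsGT_prod one_pos one_pos] with r hr
  have h1 := hr.1.1
  have h2 := hr.2.1
  rw [hg.comparisonInner_eq p x x (Ioc_subset_Icc_self hr.1) (Ioc_subset_Icc_self hr.2),
    hg.isGeodesicSegment_geo p x _ (Ioc_subset_Icc_self hr.1) _ (Ioc_subset_Icc_self hr.2), mul_pow,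
    mul_pow, mul_pow, sq_abs]
  field_simp
  ring

end IsGeodesicSpace

end CAT0

/-! ### Positive semidefinite kernels and tangent cones -/

/-- A real positive semidefinite kernel on a set: symmetric, with nonnegative quadratic forms for
all finitely supported coefficients. -/
def IsPosSemidefKernel {S : Type*} (k : S → S → ℝ) : Prop :=
  (∀ x y, k x y = k y x) ∧
    ∀ c : S →₀ ℝ, 0 ≤ c.sum fun x a => c.sum fun y b => a * b * k x y

open scoped InnerProductSpace in
theorem isPosSemidefKernel_inner {S H : Type*} [NormedAddCommGroup H] [InnerProductSpace ℝ H]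
    (F : S → H) : IsPosSemidefKernel fun x y => ⟪F x, F y⟫_ℝ := by
  refine ⟨fun x y => (real_inner_comm _ _), fun c => ?_⟩
  have : (c.sum fun x a => c.sum fun y b => a * b * ⟪F x, F y⟫_ℝ) =
      ⟪c.sum fun x a => a • F x, c.sum fun y b => b • F y⟫_ℝ := by
    simp only [Finsupp.sum, sum_inner, inner_sum, real_inner_smul_left, real_inner_smul_right]
    refine Finset.sum_congr rfl fun x _ => Finset.sum_congr rfl fun y _ => ?_
    rw [real_inner_comm]
    ring
  rw [this]
  exact real_inner_self_nonneg

open scoped InnerProductSpace in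
/-- A positive semidefinite kernel is the Gram kernel of a map to a Hilbert space, namely to the
reproducing kernel Hilbert space. -/
theorem IsPosSemidefKernel.exists_inner_eq {S : Type u} {k : S → S → ℝ}
    (hk : IsPosSemidefKernel k) :
    ∃ (H : Type u) (_ : NormedAddCommGroup H) (_ : InnerProductSpace ℝ H) (_ : CompleteSpace H)
      (F : S → H), ∀ x y, ⟪F x, F y⟫_ℝ = k x y := by
  let K : Matrix S S (ℝ →L[ℝ] ℝ) := fun x y => k x y • 1
  have hK : K.PosSemidef := by
    refine ((RKHS.posSemidef_tfae (K := K)).out 0 2 rfl rfl).2 ⟨?_, fun c => ?_⟩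
    · ext x y
      rw [Matrix.conjTranspose_apply]
      simp [K, hk.1 y x]
    · refine (hk.2 c).trans_eq ?_
      simp only [K, RCLike.re_to_real]
      refine Finset.sum_congr rfl fun x _ => Finset.sum_congr rfl fun y _ => ?_
      simp [hk.1 y x]
      ring
  have : Fact K.PosSemidef := ⟨hK⟩
  refine ⟨RKHS.OfKernel K, inferInstance, inferInstance, inferInstance,
    fun x => RKHS.kerFun (RKHS.OfKernel K) x 1, fun x y => ?_⟩
  rw [← RKHS.kernel_inner, RKHS.OfKernel.kernel_ofKernel]
  simp [K, hk.1 y x]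

section TangentCone

variable {X : Type v} [MetricSpace X]

namespace GeodesicFrom

variable {p : X} (α β : GeodesicFrom p)

theorem isGeodesicSegment : IsGeodesicSegment α.toFun (dist p (α.toFun 1)) := by
  obtain ⟨ℓ, _, h⟩ := α.geodesic
  have := h.dist_zero_one
  rw [α.source] at this
  rwa [this]

theorem length_pos : 0 < dist p (α.toFun 1) := by
  obtain ⟨ℓ, hℓ, h⟩ := α.geodesic
  have := h.dist_zero_one
  rw [α.source] at this
  rwa [this]


theorem toFun_eq_geo (hg : IsGeodesicSpace X) (hX : IsCAT0 X) {t : ℝ} (ht : t ∈ Icc (0 : ℝ) 1) :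
    α.toFun t = hg.geo p (α.toFun 1) t := by
  rw [IsGeodesicSpace.eq_geo (hg := hg) hX α.isGeodesicSegment ht, α.source]

/-- The limit defining the angle between two geodesics exists, and its cosine is the inner product
of the initial velocities divided by the speeds. -/
theorem angle_eq_arccos (hg : IsGeodesicSpace X) (hX : IsCAT0 X) :
    α.angle β = Real.arccos (hg.tangentInner p (α.toFun 1) (β.toFun 1) /
      (dist p (α.toFun 1) * dist p (β.toFun 1))) := by
  refine Tendsto.limUnder_eq ?_
  refine ((Real.continuous_arccos.tendsto _).comp
    ((IsGeodesicSpace.tendsto_comparisonInner (hg := hg) hX p (α.toFun 1) (β.toFun 1)).div_const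
      (dist p (α.toFun 1) * dist p (β.toFun 1)))).congr' ?_
  filter_upwards [IsGeodesicSpace.eventually_mem_Ioc_nhdsGT_prod one_pos one_pos] with q hq
  have h1 := hq.1.1
  have h2 := hq.2.1
  have hq1 := Ioc_subset_Icc_self hq.1
  have hq2 := Ioc_subset_Icc_self hq.2
  have hα := α.length_pos
  have hβ := β.length_pos
  simp only [Function.comp, comparisonAngle]
  rw [α.toFun_eq_geo hg hX hq1, β.toFun_eq_geo hg hX hq2, dist_comm (hg.geo p (α.toFun 1) q.1) p,
    hg.comparisonInner_eq _ _ _ hq1 hq2, hg.dist_left_geo _ _ hq1, hg.dist_left_geo _ _ hq2]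
  congr 1
  field_simp

theorem cos_angle (hg : IsGeodesicSpace X) (hX : IsCAT0 X) :
    Real.cos (α.angle β) = hg.tangentInner p (α.toFun 1) (β.toFun 1) /
      (dist p (α.toFun 1) * dist p (β.toFun 1)) := by
  have h := IsGeodesicSpace.abs_tangentInner_le (hg := hg) hX p (α.toFun 1) (β.toFun 1)
  have hpos : 0 < dist p (α.toFun 1) * dist p (β.toFun 1) := mul_pos α.length_pos β.length_pos
  rw [abs_le] at h
  rw [α.angle_eq_arccos β hg hX, Real.cos_arccos]
  · rw [le_div_iff₀ hpos]; linarith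
  · rw [div_le_iff₀ hpos]; linarith

theorem angle_nonneg (hg : IsGeodesicSpace X) (hX : IsCAT0 X) : 0 ≤ α.angle β := by
  rw [α.angle_eq_arccos β hg hX]; exact Real.arccos_nonneg _

theorem angle_eq_arccos_cos (hg : IsGeodesicSpace X) (hX : IsCAT0 X) :
    α.angle β = Real.arccos (Real.cos (α.angle β)) := by
  rw [α.cos_angle β hg hX, ← α.angle_eq_arccos β hg hX]

theorem angle_self (hg : IsGeodesicSpace X) (hX : IsCAT0 X) : α.angle α = 0 := by
  have hpos := α.length_pos
  rw [α.angle_eq_arccos α hg hX, IsGeodesicSpace.tangentInner_self hX, sq, div_self (by positivity),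
    Real.arccos_one]

end GeodesicFrom

open scoped InnerProductSpace

/-- A family of unit vectors realizing the angles between geodesics extends continuously to the
space of directions, and hence radially to the tangent cone. -/
theorem tangentConeEmbeds_of_inner_eq_cos (hg : IsGeodesicSpace X) (hX : IsCAT0 X) {p : X}
    {H : Type v} [NormedAddCommGroup H] [InnerProductSpace ℝ H] [CompleteSpace H]
    (e : GeodesicFrom p → H) (he : ∀ α β, ⟪e α, e β⟫_ℝ = Real.cos (α.angle β)) :
    TangentConeEmbeds p := by
  have hnorm : ∀ α, ‖e α‖ = 1 := fun α => by
    rw [← sq_eq_sq₀ (norm_nonneg _) zero_le_one, ← real_inner_self_eq_norm_sq, he,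
      α.angle_self hg hX, Real.cos_zero, one_pow]
  have hdist : ∀ α β, dist (e α) (e β) ≤ α.angle β := fun α β => by
    refine abs_le_of_sq_le_sq' ?_ (α.angle_nonneg β hg hX) |>.2
    rw [dist_eq_norm, norm_sub_sq_real, hnorm, hnorm, he]
    linarith [Real.one_sub_sq_div_two_le_cos (x := α.angle β)]
  have hcauchy : ∀ a : SpaceOfDirections p, ∃ x, Tendsto (fun n => e (a.seq n)) atTop (𝓝 x) := by
    refine fun a => cauchySeq_tendsto_of_complete (Metric.cauchySeq_iff.2 fun ε hε => ?_)
    obtain ⟨N, hN⟩ := a.cauchy ε hε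
    exact ⟨N, fun m hm n hn => (hdist _ _).trans_lt (hN m hm n hn)⟩
  choose E hE using hcauchy
  have hEnorm : ∀ a, ‖E a‖ = 1 := fun a =>
    tendsto_nhds_unique (hE a).norm (by simp only [hnorm]; exact tendsto_const_nhds)
  have hcos : ∀ a b : SpaceOfDirections p, Real.cos (a.angle b) = ⟪E a, E b⟫_ℝ := fun a b => by
    have hlim : a.angle b = Real.arccos ⟪E a, E b⟫_ℝ := by
      refine Tendsto.limUnder_eq ?_
      refine ((Real.continuous_arccos.tendsto _).comp ((hE a).inner (hE b))).congr fun n => ?_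
      simp only [Function.comp, he]
      exact ((a.seq n).angle_eq_arccos_cos (b.seq n) hg hX).symm
    have := abs_real_inner_le_norm (E a) (E b)
    rw [hEnorm, hEnorm, one_mul, abs_le] at this
    rw [hlim, Real.cos_arccos this.1 this.2]
  refine ⟨H, inferInstance, inferInstance, inferInstance, fun a => (a.radius : ℝ) • E a.dir,
    fun a b => ?_⟩
  rw [TangentCone.coneDist, hcos, ← Real.sqrt_sq (dist_nonneg (x := (a.radius : ℝ) • E a.dir)),
    dist_eq_norm, norm_sub_sq_real, norm_smul, norm_smul, hEnorm, hEnorm, real_inner_smul_left,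
    real_inner_smul_right]
  simp only [Real.norm_eq_abs, mul_one, sq_abs]
  congr 1
  ring

/-- The tangent cone at `p` embeds into a Hilbert space if and only if the inner products of
initial velocities of geodesics from `p` form a positive semidefinite kernel. -/
theorem tangentConeEmbeds_iff (hg : IsGeodesicSpace X) (hX : IsCAT0 X) (p : X) :
    TangentConeEmbeds p ↔ IsPosSemidefKernel (hg.tangentInner p) := by
  classical
  constructor
  · rintro ⟨H, _, _, _, f, hf⟩
    let γ : ∀ x : X, x ≠ p → GeodesicFrom p := fun x hx =>
      ⟨hg.geo p x, hg.geo_zero p x, dist p x, dist_pos.2 hx.symm, hg.isGeodesicSegment_geo p x⟩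
    let D : ∀ x : X, x ≠ p → SpaceOfDirections p := fun x hx =>
      ⟨fun _ => γ x hx, fun ε hε => ⟨0, fun _ _ _ _ => by
        rwa [GeodesicFrom.angle_self _ hg hX]⟩⟩
    have hD : ∀ x hx y hy, dist p x * dist p y * Real.cos ((D x hx).angle (D y hy)) =
        hg.tangentInner p x y := fun x hx y hy => by
      have h1 : (D x hx).angle (D y hy) = (γ x hx).angle (γ y hy) :=
        Tendsto.limUnder_eq tendsto_const_nhds
      have h2 := (γ x hx).cos_angle (γ y hy) hg hX
      have h3 := dist_pos.2 hx.symm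
      have h4 := dist_pos.2 hy.symm
      simp only [γ, IsGeodesicSpace.geo_one] at h2
      rw [h1, h2]
      field_simp
    let F : X → H := fun x => if hx : x = p then 0 else
      dist p x • (f ⟨D x hx, 1⟩ - f ⟨D x hx, 0⟩)
    have hF : hg.tangentInner p = fun x y => ⟪F x, F y⟫_ℝ := by
      have hzero : ∀ y, hg.tangentInner p p y = 0 := fun y => by
        have := IsGeodesicSpace.abs_tangentInner_le (hg := hg) hX p p y
        rwa [dist_self, zero_mul, abs_nonpos_iff] at this
      funext x y
      by_cases hx : x = p
      · simp [F, hx, hzero]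
      by_cases hy : y = p
      · simp [F, hy, hzero, IsGeodesicSpace.tangentInner_comm hX p x p]
      simp only [F, dif_neg hx, dif_neg hy, real_inner_smul_left, real_inner_smul_right]
      have hapex : f ⟨D y hy, 0⟩ = f ⟨D x hx, 0⟩ := by
        rw [← dist_eq_zero, hf]
        simp [TangentCone.coneDist]
      have hx1 : ‖f ⟨D x hx, 1⟩ - f ⟨D x hx, 0⟩‖ = 1 := by
        rw [← dist_eq_norm, hf]
        simp [TangentCone.coneDist]
      have hy1 : ‖f ⟨D y hy, 1⟩ - f ⟨D x hx, 0⟩‖ = 1 := by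
        rw [← hapex, ← dist_eq_norm, hf]
        simp [TangentCone.coneDist]
      have hxy : ‖(f ⟨D x hx, 1⟩ - f ⟨D x hx, 0⟩) - (f ⟨D y hy, 1⟩ - f ⟨D x hx, 0⟩)‖ ^ 2 =
          2 - 2 * Real.cos ((D x hx).angle (D y hy)) := by
        rw [sub_sub_sub_cancel_right, ← dist_eq_norm, hf, TangentCone.coneDist, Real.sq_sqrt]
        · simp only [NNReal.coe_one]; ring
        · simp only [NNReal.coe_one]
          linarith [Real.cos_le_one ((D x hx).angle (D y hy))]
      rw [norm_sub_sq_real, hx1, hy1] at hxy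
      rw [hapex, ← hD x hx y hy]
      linear_combination (dist p x * dist p y) * hxy / 2
    rw [hF]
    exact isPosSemidefKernel_inner F
  · intro h
    obtain ⟨H, _, _, _, F, hF⟩ := h.exists_inner_eq
    refine tangentConeEmbeds_of_inner_eq_cos hg hX
      (fun α => (dist p (α.toFun 1))⁻¹ • F (α.toFun 1)) fun α β => ?_
    rw [real_inner_smul_left, real_inner_smul_right, hF, α.cos_angle β hg hX]
    have hα := α.length_pos
    have hβ := β.length_pos
    field_simp

end TangentCone

/-! ### Continuum products of Hilbert--Hadamard spaces -/

namespace ContinuumProduct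

variable {Y : Type w} [MeasurableSpace Y] {μ : Measure Y} {X : Type v} [MetricSpace X]

theorem memLp_dist_left [IsFiniteMeasure μ] (ξ : ContinuumProduct μ X) (x : X) :
    MemLp (fun y => dist (ξ.1 y) x) 2 μ := by
  obtain ⟨x₀, hx₀⟩ := ξ.2
  refine ((memLp_dist_const ξ.1 x₀ hx₀).add (memLp_const (dist x₀ x))).mono
    (ξ.1.aestronglyMeasurable.dist aestronglyMeasurable_const) (Eventually.of_forall fun y => ?_)
  simp only [Pi.add_apply, Real.norm_eq_abs]
  rw [abs_of_nonneg dist_nonneg, abs_of_nonneg (by positivity)]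
  exact dist_triangle _ _ _

/-- The class of a square integrable map. -/
noncomputable def mk (f : Y → X) (hf : AEStronglyMeasurable f μ) (x₀ : X)
    (h : MemLp (fun y => dist (f y) x₀) 2 μ) : ContinuumProduct μ X :=
  ⟨AEEqFun.mk f hf, x₀, by
    have h2 := h.2
    rw [eLpNorm_lt_top_iff_lintegral_rpow_enorm_lt_top (by norm_num) (by norm_num)] at h2
    refine lt_of_le_of_lt (le_of_eq (lintegral_congr_ae ?_)) h2
    filter_upwards [AEEqFun.coeFn_mk f hf] with y hy
    rw [hy, Real.enorm_eq_ofReal dist_nonneg, ← edist_dist]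
    norm_num⟩

theorem coeFn_mk (f : Y → X) (hf : AEStronglyMeasurable f μ) (x₀ : X)
    (h : MemLp (fun y => dist (f y) x₀) 2 μ) : (mk f hf x₀ h).1 =ᵐ[μ] f :=
  AEEqFun.coeFn_mk f hf

@[ext]
theorem ext {ξ η : ContinuumProduct μ X} (h : ξ.1 =ᵐ[μ] η.1) : ξ = η :=
  Subtype.ext (AEEqFun.ext h)

theorem dist_sq_eq (ξ η : ContinuumProduct μ X) :
    dist ξ η ^ 2 = ∫ y, dist (ξ.1 y) (η.1 y) ^ 2 ∂μ := by
  rw [dist_def, Real.sq_sqrt (integral_nonneg fun y => sq_nonneg _)]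

theorem nonempty (h : Nonempty X) : Nonempty (ContinuumProduct μ X) :=
  h.map fun x => mk (fun _ => x) aestronglyMeasurable_const x (by simp)

variable [IsFiniteMeasure μ]

theorem integrable_dist_sq (ξ η : ContinuumProduct μ X) :
    Integrable (fun y => dist (ξ.1 y) (η.1 y) ^ 2) μ :=
  (memLp_dist ξ η).integrable_sq

theorem dist_eq_mul_dist_of_ae {ξ η ξ' η' : ContinuumProduct μ X} {c : ℝ} (hc : 0 ≤ c)
    (h : ∀ᵐ y ∂μ, dist (ξ.1 y) (η.1 y) = c * dist (ξ'.1 y) (η'.1 y)) :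
    dist ξ η = c * dist ξ' η' := by
  rw [← sq_eq_sq₀ dist_nonneg (by positivity), mul_pow, dist_sq_eq, dist_sq_eq,
    ← integral_const_mul]
  refine integral_congr_ae ?_
  filter_upwards [h] with y hy
  rw [hy, mul_pow]

/-- `L²(Y, μ, X)` is complete: through the Kuratowski embedding `X ⊆ ℓ^∞` it is identified with a
closed subset of a Bochner space. -/
theorem completeSpace [CompleteSpace X] [SecondCountableTopology X] :
    CompleteSpace (ContinuumProduct μ X) := by
  let κ := kuratowskiEmbedding X
  have hκ : Isometry κ := kuratowskiEmbedding.isometry X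
  have hmem : ∀ ξ : ContinuumProduct μ X, MemLp (fun y => κ (ξ.1 y)) 2 μ := by
    intro ξ
    obtain ⟨x, -⟩ := ξ.2
    refine ((memLp_dist_left ξ x).add (memLp_const ‖κ x‖)).mono
      (hκ.continuous.comp_aestronglyMeasurable ξ.1.aestronglyMeasurable)
      (Eventually.of_forall fun y => ?_)
    simp only [Pi.add_apply, Real.norm_eq_abs]
    rw [abs_of_nonneg (by positivity), ← hκ.dist_eq, dist_eq_norm]
    have := norm_add_le (κ (ξ.1 y) - κ x) (κ x)
    rwa [sub_add_cancel] at this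
  let J : ContinuumProduct μ X → Lp (lp (fun _ : ℕ => ℝ) ∞) 2 μ := fun ξ => (hmem ξ).toLp _
  have hJ : Isometry J := by
    refine Isometry.of_dist_eq fun ξ η => ?_
    rw [Lp.dist_def, dist_eq_eLpNorm]
    congr 1
    refine eLpNorm_congr_norm_ae ?_
    filter_upwards [(hmem ξ).coeFn_toLp, (hmem η).coeFn_toLp] with y h1 h2
    rw [Pi.sub_apply, h1, h2, ← dist_eq_norm, hκ.dist_eq, Real.norm_eq_abs,
      abs_of_nonneg dist_nonneg]
  rw [completeSpace_iff_isComplete_range hJ.isUniformInducing]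
  refine IsClosed.isComplete (isSeqClosed_iff_isClosed.1 fun G g hG hlim => ?_)
  choose ξ hξ using hG
  obtain ⟨ns, -, hns⟩ := (tendstoInMeasure_of_tendsto_Lp hlim).exists_seq_tendsto_ae
  have hclosed : IsClosed (range κ) := hκ.isClosedEmbedding.isClosed_range
  have hrange : ∀ᵐ y ∂μ, g y ∈ range κ := by
    have hall : ∀ᵐ y ∂μ, ∀ n, G n y = κ ((ξ n).1 y) := by
      rw [ae_all_iff]
      intro n
      rw [← hξ n]
      exact (hmem (ξ n)).coeFn_toLp
    filter_upwards [hns, hall] with y h1 h2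
    exact hclosed.mem_of_tendsto h1 (Eventually.of_forall fun n => ⟨_, (h2 _).symm⟩)
  obtain ⟨x₀, -⟩ := (ξ 0).2
  classical
  let f : Y → X := fun y => if h : g y ∈ range κ then h.choose else x₀
  have hf : (fun y => κ (f y)) =ᵐ[μ] g := by
    filter_upwards [hrange] with y hy
    simp only [f, dif_pos hy]
    exact hy.choose_spec
  have hfm : AEStronglyMeasurable f μ :=
    hκ.isEmbedding.aestronglyMeasurable_comp_iff.1
      ((Lp.aestronglyMeasurable g).congr hf.symm)
  have hf2 : MemLp (fun y => dist (f y) x₀) 2 μ := by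
    refine ((Lp.memLp g).sub (memLp_const (κ x₀))).norm.congr_norm
      (hfm.dist aestronglyMeasurable_const) ?_
    filter_upwards [hf] with y hy
    rw [Pi.sub_apply, ← hy, ← dist_eq_norm, hκ.dist_eq]
  refine ⟨mk f hfm x₀ hf2, Lp.ext ?_⟩
  filter_upwards [(hmem (mk f hfm x₀ hf2)).coeFn_toLp, coeFn_mk f hfm x₀ hf2, hf] with y h1 h2 h3
  rw [h1, h2, h3]

theorem exists_coeFn_ae_eq_geo (hg : IsGeodesicSpace X) (hX : IsCAT0 X)
    (ξ η : ContinuumProduct μ X) {t : ℝ} (ht : t ∈ Icc (0 : ℝ) 1) :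
    ∃ ζ : ContinuumProduct μ X, ζ.1 =ᵐ[μ] fun y => hg.geo (ξ.1 y) (η.1 y) t := by
  obtain ⟨x₀, -⟩ := ξ.2
  have hm : AEStronglyMeasurable (fun y => hg.geo (ξ.1 y) (η.1 y) t) μ :=
    (IsGeodesicSpace.continuous_geo (hg := hg) hX continuous_fst continuous_snd
      (continuous_const (y := t)) fun _ => ht).comp_aestronglyMeasurable
      (ξ.1.aestronglyMeasurable.prodMk η.1.aestronglyMeasurable)
  refine ⟨mk _ hm x₀ (((memLp_dist ξ η).add (memLp_dist_left ξ x₀)).mono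
    (hm.dist aestronglyMeasurable_const) (Eventually.of_forall fun y => ?_)), coeFn_mk _ _ _ _⟩
  simp only [Pi.add_apply, Real.norm_eq_abs]
  rw [abs_of_nonneg dist_nonneg, abs_of_nonneg (by positivity)]
  refine (dist_triangle_left _ x₀ (ξ.1 y)).trans ?_
  rw [hg.dist_left_geo _ _ ht]
  gcongr
  exact mul_le_of_le_one_left dist_nonneg ht.2

theorem isGeodesicSpace (hg : IsGeodesicSpace X) (hX : IsCAT0 X) :
    IsGeodesicSpace (ContinuumProduct μ X) := by
  classical
  intro ξ η
  choose ζ hζ using fun (t : ℝ) (ht : t ∈ Icc (0 : ℝ) 1) => exists_coeFn_ae_eq_geo hg hX ξ η ht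
  refine ⟨fun t => if ht : t ∈ Icc (0 : ℝ) 1 then ζ t ht else ξ, ?_, ?_, fun s hs t ht => ?_⟩
  · simp only [dif_pos (show (0 : ℝ) ∈ Icc (0 : ℝ) 1 by simp)]
    ext
    filter_upwards [hζ 0 (by simp)] with y hy
    rw [hy, hg.geo_zero]
  · simp only [dif_pos (show (1 : ℝ) ∈ Icc (0 : ℝ) 1 by simp)]
    ext
    filter_upwards [hζ 1 (by simp)] with y hy
    rw [hy, hg.geo_one]
  · simp only [dif_pos hs, dif_pos ht]
    refine dist_eq_mul_dist_of_ae (abs_nonneg _) ?_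
    filter_upwards [hζ s hs, hζ t ht] with y h1 h2
    rw [h1, h2, hg.isGeodesicSegment_geo _ _ s hs t ht]

theorem isCAT0 (hg : IsGeodesicSpace X) (hX : IsCAT0 X) : IsCAT0 (ContinuumProduct μ X) := by
  intro p q r m hm
  have hhalf : (1 / 2 : ℝ) ∈ Icc (0 : ℝ) 1 := by norm_num
  obtain ⟨c, hc⟩ := exists_coeFn_ae_eq_geo hg hX q r hhalf
  -- The CN inequality for the pointwise midpoint `c` also yields `m = c`.
  have hCN : ∀ p, dist p c ^ 2 ≤
      (1 / 2) * dist p q ^ 2 + (1 / 2) * dist p r ^ 2 - (1 / 4) * dist q r ^ 2 := by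
    intro p
    rw [dist_sq_eq, dist_sq_eq, dist_sq_eq, dist_sq_eq, ← integral_const_mul,
      ← integral_const_mul, ← integral_const_mul, ← integral_add, ← integral_sub]
    · refine integral_mono_ae (integrable_dist_sq p c) ?_ ?_
      · exact (((integrable_dist_sq p q).const_mul _).add
          ((integrable_dist_sq p r).const_mul _)).sub ((integrable_dist_sq q r).const_mul _)
      · filter_upwards [hc] with y hy
        have := IsGeodesicSpace.dist_geo_sq_le (hg := hg) hX (p.1 y) (q.1 y) (r.1 y) hhalf
        rw [hy]
        linarith
    · exact ((integrable_dist_sq p q).const_mul _).add ((integrable_dist_sq p r).const_mul _)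
    · exact (integrable_dist_sq q r).const_mul _
    · exact (integrable_dist_sq p q).const_mul _
    · exact (integrable_dist_sq p r).const_mul _
  have hmc : m = c := by
    have h := hCN m
    rw [dist_comm m q, dist_comm m r, hm.1, hm.2] at h
    have h0 : dist m c ^ 2 ≤ 0 := by linarith
    exact dist_eq_zero.1 (pow_eq_zero_iff two_ne_zero |>.1 (le_antisymm h0 (sq_nonneg _)))
  have h := hCN p
  rw [← hmc, dist_comm p m] at h
  linarith

/-- Geodesics in `L²(Y, μ, X)` are pointwise geodesics in `X`. -/
theorem geo_ae_eq (hg : IsGeodesicSpace X) (hX : IsCAT0 X)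
    (hg' : IsGeodesicSpace (ContinuumProduct μ X))
    (ξ η : ContinuumProduct μ X) {t : ℝ} (ht : t ∈ Icc (0 : ℝ) 1) :
    (hg'.geo ξ η t).1 =ᵐ[μ] fun y => hg.geo (ξ.1 y) (η.1 y) t := by
  obtain ⟨ζ, hζ⟩ := exists_coeFn_ae_eq_geo hg hX ξ η ht
  have : ζ = hg'.geo ξ η t := by
    refine IsGeodesicSpace.eq_geo_of_dist (isCAT0 hg hX) ht (dist_eq_mul_dist_of_ae ht.1 ?_)
      (dist_eq_mul_dist_of_ae (by linarith [ht.2]) ?_)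
    · filter_upwards [hζ] with y hy
      rw [hy, hg.dist_left_geo _ _ ht]
    · filter_upwards [hζ] with y hy
      rw [hy, hg.dist_geo_right _ _ ht]
  rw [← this]
  exact hζ

theorem comparisonInner_ae_eq (hg : IsGeodesicSpace X) (hX : IsCAT0 X)
    (hg' : IsGeodesicSpace (ContinuumProduct μ X))
    (π ξ η : ContinuumProduct μ X) {s t : ℝ} (hs : s ∈ Icc (0 : ℝ) 1) (ht : t ∈ Icc (0 : ℝ) 1) :
    (fun y => (dist (π.1 y) ((hg'.geo π ξ s).1 y) ^ 2 + dist (π.1 y) ((hg'.geo π η t).1 y) ^ 2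
      - dist ((hg'.geo π ξ s).1 y) ((hg'.geo π η t).1 y) ^ 2) / (2 * s * t)) =ᵐ[μ]
    fun y => hg.comparisonInner (π.1 y) (ξ.1 y) (η.1 y) s t := by
  filter_upwards [geo_ae_eq hg hX hg' π ξ hs, geo_ae_eq hg hX hg' π η ht] with y h1 h2
  rw [h1, h2, IsGeodesicSpace.comparisonInner]

theorem aestronglyMeasurable_comparisonInner (hg : IsGeodesicSpace X) (hX : IsCAT0 X)
    (π ξ η : ContinuumProduct μ X) {s t : ℝ} (hs : s ∈ Icc (0 : ℝ) 1) (ht : t ∈ Icc (0 : ℝ) 1) :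
    AEStronglyMeasurable (fun y => hg.comparisonInner (π.1 y) (ξ.1 y) (η.1 y) s t) μ := by
  have hg' : IsGeodesicSpace (ContinuumProduct μ X) := isGeodesicSpace hg hX
  refine AEStronglyMeasurable.congr ?_ (comparisonInner_ae_eq hg hX hg' π ξ η hs ht)
  exact (((integrable_dist_sq _ _).add (integrable_dist_sq _ _)).sub
    (integrable_dist_sq _ _)).div_const _ |>.aestronglyMeasurable

theorem integrable_dist_mul_dist (π ξ η : ContinuumProduct μ X) :
    Integrable (fun y => dist (π.1 y) (ξ.1 y) * dist (π.1 y) (η.1 y)) μ :=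
  (memLp_dist π ξ).integrable_mul (memLp_dist π η)

theorem comparisonInner_eq_integral (hg : IsGeodesicSpace X) (hX : IsCAT0 X)
    (hg' : IsGeodesicSpace (ContinuumProduct μ X)) (π ξ η : ContinuumProduct μ X) {s t : ℝ}
    (hs : s ∈ Icc (0 : ℝ) 1) (ht : t ∈ Icc (0 : ℝ) 1) :
    hg'.comparisonInner π ξ η s t =
      ∫ y, hg.comparisonInner (π.1 y) (ξ.1 y) (η.1 y) s t ∂μ := by
  rw [← integral_congr_ae (comparisonInner_ae_eq hg hX hg' π ξ η hs ht), integral_div,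
    integral_sub, integral_add, IsGeodesicSpace.comparisonInner, dist_sq_eq, dist_sq_eq, dist_sq_eq]
  · exact integrable_dist_sq _ _
  · exact integrable_dist_sq _ _
  · exact (integrable_dist_sq _ _).add (integrable_dist_sq _ _)
  · exact integrable_dist_sq _ _

theorem integrable_tangentInner (hg : IsGeodesicSpace X) (hX : IsCAT0 X)
    (π ξ η : ContinuumProduct μ X) :
    Integrable (fun y => hg.tangentInner (π.1 y) (ξ.1 y) (η.1 y)) μ := by
  suffices hm : AEStronglyMeasurable
      (fun y => hg.tangentInner (π.1 y) (ξ.1 y) (η.1 y)) μ by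
    refine (integrable_dist_mul_dist π ξ η).mono' hm (Eventually.of_forall fun y => ?_)
    rw [Real.norm_eq_abs]
    exact IsGeodesicSpace.abs_tangentInner_le hX _ _ _
  obtain ⟨r, -, hI, hlim⟩ := exists_seq_strictAnti_tendsto' (show (0 : ℝ) < 1 by norm_num)
  have hlim' : Tendsto r atTop (𝓝[>] 0) :=
    tendsto_nhdsWithin_iff.2 ⟨hlim, Eventually.of_forall fun n => (hI n).1⟩
  refine aestronglyMeasurable_of_tendsto_ae atTop
    (f := fun n y => hg.comparisonInner (π.1 y) (ξ.1 y) (η.1 y) (r n) (r n)) (fun n : ℕ =>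
    aestronglyMeasurable_comparisonInner hg hX π ξ η (Ioo_subset_Icc_self (hI n))
      (Ioo_subset_Icc_self (hI n))) (Eventually.of_forall fun y => ?_)
  have h := IsGeodesicSpace.tendsto_comparisonInner (hg := hg) hX (π.1 y) (ξ.1 y) (η.1 y)
  have hr : Tendsto (fun n => (r n, r n)) atTop (𝓝[>] (0 : ℝ) ×ˢ 𝓝[>] (0 : ℝ)) :=
    hlim'.prodMk hlim'
  exact (h.comp hr).congr fun n => rfl

/-- The inner product on the tangent cones of `L²(Y, μ, X)` is the integral of the inner products
on the tangent cones of `X`. -/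
theorem tangentInner_eq_integral (hg : IsGeodesicSpace X) (hX : IsCAT0 X)
    (hg' : IsGeodesicSpace (ContinuumProduct μ X)) (π ξ η : ContinuumProduct μ X) :
    hg'.tangentInner π ξ η = ∫ y, hg.tangentInner (π.1 y) (ξ.1 y) (η.1 y) ∂μ := by
  have hev := IsGeodesicSpace.eventually_mem_Ioc_nhdsGT_prod (one_pos (α := ℝ)) one_pos
  refine Tendsto.limUnder_eq ?_
  refine (tendsto_integral_filter_of_dominated_convergence
    (F := fun q : ℝ × ℝ => fun y => hg.comparisonInner (π.1 y) (ξ.1 y) (η.1 y) q.1 q.2)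
    (fun y => dist (π.1 y) (ξ.1 y) * dist (π.1 y) (η.1 y)) ?_ ?_ (integrable_dist_mul_dist π ξ η)
    (Eventually.of_forall fun y =>
      IsGeodesicSpace.tendsto_comparisonInner (hg := hg) hX _ _ _)).congr' ?_
  · filter_upwards [hev] with q hq
    exact aestronglyMeasurable_comparisonInner hg hX π ξ η (Ioc_subset_Icc_self hq.1)
      (Ioc_subset_Icc_self hq.2)
  · filter_upwards [hev] with q hq
    exact Eventually.of_forall fun y => hg.abs_comparisonInner_le _ _ _ hq.1 hq.2
  · filter_upwards [hev] with q hq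
    exact (comparisonInner_eq_integral hg hX hg' π ξ η (Ioc_subset_Icc_self hq.1)
      (Ioc_subset_Icc_self hq.2)).symm

/-- The `L²`-continuum product of a separable Hilbert--Hadamard space is a Hilbert--Hadamard
space. -/
theorem isHilbertHadamard [SecondCountableTopology X] (hX : IsHilbertHadamard X) :
    IsHilbertHadamard (ContinuumProduct μ X) := by
  have := hX.complete
  have hg := hX.geodesic
  have hc := hX.cat0
  refine ⟨nonempty hX.nonempty, completeSpace, isGeodesicSpace hg hc, isCAT0 hg hc, fun π => ?_⟩
  have hg' : IsGeodesicSpace (ContinuumProduct μ X) := isGeodesicSpace hg hc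
  have hc' : IsCAT0 (ContinuumProduct μ X) := isCAT0 hg hc
  rw [tangentConeEmbeds_iff hg' hc']
  refine ⟨IsGeodesicSpace.tangentInner_comm hc' π, fun c => ?_⟩
  have hint : ∀ ξ η : ContinuumProduct μ X, ∀ a : ℝ,
      Integrable (fun y => a * hg.tangentInner (π.1 y) (ξ.1 y) (η.1 y)) μ :=
    fun ξ η a => (integrable_tangentInner hg hc π ξ η).const_mul a
  have hsum : (c.sum fun ξ a => c.sum fun η b => a * b * hg'.tangentInner π ξ η) =
      ∫ y, c.sum fun ξ a => c.sum fun η b =>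
        a * b * hg.tangentInner (π.1 y) (ξ.1 y) (η.1 y) ∂μ := by
    simp only [Finsupp.sum]
    rw [integral_finsetSum _ fun ξ _ => integrable_finsetSum _ fun η _ => hint ξ η _]
    refine Finset.sum_congr rfl fun ξ _ => ?_
    rw [integral_finsetSum _ fun η _ => hint ξ η _]
    refine Finset.sum_congr rfl fun η _ => ?_
    rw [integral_const_mul, tangentInner_eq_integral hg hc hg' π ξ η]
  rw [hsum]
  refine integral_nonneg fun y => ?_
  have hpsd := (tangentConeEmbeds_iff hg hc (π.1 y)).1 (hX.tangentCone _)
  obtain ⟨H, _, _, _, F, hF⟩ := hpsd.exists_inner_eq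
  have h := (isPosSemidefKernel_inner fun ξ : ContinuumProduct μ X => F (ξ.1 y)).2 c
  simp only [hF] at h
  exact h

end ContinuumProduct

/-! ### Isomorphisms and trivializations of fields -/

namespace MetricField

variable {Z : Type u} [TopologicalSpace Z]

namespace Isomorphic

variable {Y : Type u'} [TopologicalSpace Y] {C : MetricField.{u, v} Z} {D : MetricField.{u', v'} Y}

theorem symm (h : Isomorphic C D) : Isomorphic D C := by
  obtain ⟨φ, ψ, h₁, h₂⟩ := h
  exact ⟨ψ, φ, h₂, h₁⟩

theorem trans {W : Type u''} [TopologicalSpace W] {E : MetricField.{u'', v''} W}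
    (h : Isomorphic C D) (h' : Isomorphic D E) : Isomorphic C E := by
  obtain ⟨φ, ψ, h₁, h₂⟩ := h
  obtain ⟨φ', ψ', h₁', h₂'⟩ := h'
  refine ⟨φ'.comp φ, ψ.comp ψ', ?_, ?_⟩
  · calc (ψ.comp ψ').comp (φ'.comp φ) = ψ.comp ((ψ'.comp φ').comp φ) := rfl
      _ = Morphism.id C := by rw [h₁']; exact h₁
  · calc (φ'.comp φ).comp (ψ.comp ψ') = φ'.comp ((φ.comp ψ).comp ψ') := rfl
      _ = Morphism.id E := by rw [h₂]; exact h₂'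

theorem surjective_map {φ : Morphism C D} {ψ : Morphism D C} (h : φ.comp ψ = Morphism.id D)
    (y : Y) : Function.Surjective (φ.map y) := by
  have key : ∀ M : Morphism D D, M = Morphism.id D → Function.Surjective (M.map y) := by
    rintro M rfl
    exact Function.surjective_id
  exact Function.Surjective.of_comp (key _ h)

theorem base_base {φ : Morphism C D} {ψ : Morphism D C} (h : φ.comp ψ = Morphism.id D) (y : Y) :
    ψ.base (φ.base y) = y :=
  congrFun (congrArg Morphism.base h) y

theorem mem_cont_of_map_mem {φ : Morphism C D} {ψ : Morphism D C}
    (h : ψ.comp φ = Morphism.id C) {s : ∀ z, C.fiber z}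
    (hs : (fun y => φ.map y (s (φ.base y))) ∈ D.cont) : s ∈ C.cont := by
  have key : ∀ M : Morphism C C, M = Morphism.id C →
      (fun z => M.map z (s (M.base z))) ∈ C.cont → s ∈ C.cont := by
    rintro M rfl
    exact fun h => h
  exact key _ h (ψ.map_cont _ hs)

/-- An isomorphism of fields consists of a homeomorphism of the base spaces and of bijective
isometries of the fibers that identify the sets of sections. -/
theorem exists_isometryEquiv (h : Isomorphic C D) :
    ∃ (f : Y ≃ₜ Z) (e : ∀ y, C.fiber (f y) ≃ᵢ D.fiber y),
      ∀ s : ∀ z, C.fiber z, s ∈ C.cont ↔ (fun y => e y (s (f y))) ∈ D.cont := by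
  obtain ⟨φ, ψ, h₁, h₂⟩ := h
  refine ⟨⟨⟨φ.base, ψ.base, base_base h₂, base_base h₁⟩, φ.continuous_base, ψ.continuous_base⟩,
    fun y => ⟨Equiv.ofBijective (φ.map y) ⟨(φ.isometry_map y).injective, surjective_map h₂ y⟩,
      φ.isometry_map y⟩, fun s => ⟨fun hs => φ.map_cont s hs, fun hs => mem_cont_of_map_mem h₁ hs⟩⟩

end Isomorphic

theorem isomorphic_of_isometryEquiv {C : MetricField.{u, v} Z} {D : MetricField.{u, v'} Z}
    (e : ∀ z, C.fiber z ≃ᵢ D.fiber z)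
    (he : ∀ s : ∀ z, C.fiber z, s ∈ C.cont ↔ (fun z => e z (s z)) ∈ D.cont) : Isomorphic C D := by
  refine ⟨⟨fun z => z, fun z => e z, continuous_id, fun z => (e z).isometry,
    fun s hs => (he s).1 hs⟩, ⟨fun z => z, fun z => (e z).symm, continuous_id,
    fun z => (e z).symm.isometry, fun s hs => (he _).2 (by simpa using hs)⟩, ?_, ?_⟩
  · simp [Morphism.comp, Morphism.id]
  · simp [Morphism.comp, Morphism.id]

theorem isomorphic_const_of_isometryEquiv {X : Type v} [MetricSpace X] {X' : Type v'}
    [MetricSpace X'] (e : X ≃ᵢ X') : Isomorphic (const Z X) (const Z X') :=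
  isomorphic_of_isometryEquiv (fun _ => e) fun _ => e.toHomeomorph.comp_continuous_iff.symm

/-- An isomorphism with a constant field can be chosen over the identity of the base space. -/
theorem isomorphic_const_iff {C : MetricField.{u, v} Z} {X : Type v'} [MetricSpace X] :
    Isomorphic C (const Z X) ↔
      ∃ e : ∀ z, C.fiber z ≃ᵢ X, ∀ s, s ∈ C.cont ↔ Continuous fun z => e z (s z) := by
  refine ⟨fun h => ?_, fun ⟨e, he⟩ => isomorphic_of_isometryEquiv e he⟩
  obtain ⟨f, e', he'⟩ := h.exists_isometryEquiv
  have key : ∀ z y, f y = z → ∃ e : C.fiber z ≃ᵢ X,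
      ∀ s : ∀ z, C.fiber z, e (s z) = e' y (s (f y)) := by
    rintro _ y rfl
    exact ⟨e' y, fun _ => rfl⟩
  choose e he using fun z => key z (f.symm z) (f.apply_symm_apply z)
  refine ⟨e, fun s => (he' s).trans ?_⟩
  simp only [he]
  exact (f.symm.comp_continuous_iff' (f := fun y => e' y (s (f y)))).symm

/-- If the continuous sections in `S` take dense sets of values and become continuous under the
fiberwise isometries `e`, then so do all sections whose distances to members of `S` are
continuous. -/
theorem continuousAt_of_dense {C : MetricField.{u, v} Z} {X : Type v'} [MetricSpace X]
    (e : ∀ z, C.fiber z ≃ᵢ X) {S : Set (∀ z, C.fiber z)} {z₀ : Z}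
    (hS : ∀ s ∈ S, ContinuousAt (fun z => e z (s z)) z₀)
    (hd : Dense ((fun s : ∀ z, C.fiber z => s z₀) '' S)) {s : ∀ z, C.fiber z}
    (hs : ∀ t ∈ S, ContinuousAt (fun z => dist (s z) (t z)) z₀) :
    ContinuousAt (fun z => e z (s z)) z₀ := by
  refine Metric.continuousAt_iff'.2 fun ε hε => ?_
  obtain ⟨_, ⟨t, ht, rfl⟩, hlt⟩ := hd.exists_dist_lt (s z₀) (show 0 < ε / 3 by positivity)
  have h1 : ∀ᶠ z in 𝓝 z₀, dist (s z) (t z) < ε / 3 := (hs t ht).eventually_lt_const hlt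
  filter_upwards [h1, Metric.continuousAt_iff'.1 (hS t ht) (ε / 3) (by positivity)] with z h2 h3
  calc dist (e z (s z)) (e z₀ (s z₀))
      ≤ dist (e z (s z)) (e z (t z)) + dist (e z (t z)) (e z₀ (t z₀))
        + dist (e z₀ (t z₀)) (e z₀ (s z₀)) := dist_triangle4 _ _ _ _
    _ < ε / 3 + ε / 3 + ε / 3 := by
        rw [(e z).dist_eq, (e z₀).dist_eq, dist_comm (t z₀)]
        gcongr
    _ = ε := by ring

/-- Fiberwise isometries to `X` under which a pointwise dense set `S` of sections becomes continuous
identify the sections generated by `S` with the continuous maps to `X`. -/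
theorem mem_generatedSections_iff {C : MetricField.{u, v} Z} {X : Type v'} [MetricSpace X]
    (e : ∀ z, C.fiber z ≃ᵢ X) {S : Set (∀ z, C.fiber z)}
    (hS : ∀ s ∈ S, Continuous fun z => e z (s z))
    (hd : ∀ z, Dense ((fun s : ∀ z, C.fiber z => s z) '' S)) (s : ∀ z, C.fiber z) :
    s ∈ generatedSections S ↔ Continuous fun z => e z (s z) := by
  refine ⟨fun hs => continuous_iff_continuousAt.2 fun z₀ => continuousAt_of_dense e
    (fun t ht => (hS t ht).continuousAt) (hd z₀) fun t ht =>
    (hs s (mem_insert _ _) t (mem_insert_of_mem _ ht)).continuousAt, fun hs => ?_⟩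
  have hall : ∀ t ∈ insert s S, Continuous fun z => e z (t z) := by
    rintro t (rfl | ht)
    exacts [hs, hS t ht]
  intro t ht t' ht'
  simpa only [(e _).dist_eq] using (hall t ht).dist (hall t' ht')

/-- Trivial fields are locally trivial and have isometric fibers. -/
theorem IsTrivial.isLocallyTrivial_and_hasIsometricFibers {C : MetricField.{u, v} Z}
    (h : C.IsTrivial) : C.IsLocallyTrivial ∧ C.HasIsometricFibers := by
  obtain ⟨X, _, hX, hiso⟩ := h
  obtain ⟨e, he⟩ := isomorphic_const_iff.1 hiso
  refine ⟨fun z => ⟨univ, isOpen_univ, mem_univ z, X, inferInstance, hX,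
    isomorphic_const_iff.2 ⟨fun y => e y, fun s => ?_⟩⟩, X, inferInstance, hX, fun z => ⟨e z⟩⟩
  refine mem_generatedSections_iff (C := C.restrict univ) (fun y => e y) ?_ (fun y => ?_) s
  · rintro _ ⟨t, ht, rfl⟩
    exact ((he t).1 ht).comp continuous_subtype_val
  · refine Dense.mono ?_ dense_univ
    rintro x -
    refine ⟨_, ⟨fun z => (e z).symm (e y x), (he _).2 (by simpa using continuous_const), rfl⟩, ?_⟩
    exact (e y).symm_apply_apply x

/-- Fiberwise isometries to `X` that trivialize the field over the subset `U`. -/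
def TrivializesOn (C : MetricField.{u, v} Z) {X : Type v'} [MetricSpace X]
    (e : ∀ z, C.fiber z ≃ᵢ X) (U : Set Z) : Prop :=
  ∀ s ∈ C.cont, ContinuousOn (fun z => e z (s z)) U

theorem IsLocallyTrivial.exists_trivializesOn {C : MetricField.{u, v} Z}
    (h : C.IsLocallyTrivial) (hC : MutuallyCocontinuous C.cont) {X : Type v'} [MetricSpace X]
    (hX : ∀ z, Nonempty (C.fiber z ≃ᵢ X)) (z₀ : Z) :
    ∃ (e : ∀ z, C.fiber z ≃ᵢ X) (U : Set Z), IsOpen U ∧ z₀ ∈ U ∧ C.TrivializesOn e U := by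
  classical
  obtain ⟨U, hU, hz₀, X', _, -, hiso⟩ := h z₀
  obtain ⟨e, he⟩ := isomorphic_const_iff.1 hiso
  let i : ∀ z, C.fiber z ≃ᵢ X := fun z => (hX z).some
  let j : X' ≃ᵢ X := (e ⟨z₀, hz₀⟩).symm.trans (i z₀)
  let E : ∀ z, C.fiber z ≃ᵢ X := fun z =>
    if hz : z ∈ U then IsometryEquiv.trans (α := C.fiber z) (e ⟨z, hz⟩) j else i z
  have hE : ∀ y : U, E y = IsometryEquiv.trans (α := C.fiber y) (e y) j := fun y => dif_pos y.2
  refine ⟨E, U, hU, hz₀, fun s hs => ?_⟩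
  rw [continuousOn_iff_continuous_domRestrict]
  have hmem : (fun y : U => s y) ∈ (C.restrict U).cont := by
    have hs' : (fun y : U => s y) ∈ (fun (s : ∀ z, C.fiber z) (y : U) => s y) '' C.cont :=
      ⟨s, hs, rfl⟩
    change MutuallyCocontinuous (insert _ _)
    rw [insert_eq_of_mem hs']
    rintro _ ⟨t, ht, rfl⟩ _ ⟨t', ht', rfl⟩
    exact (hC t ht t' ht').comp continuous_subtype_val
  refine (j.continuous.comp ((he _).1 hmem)).congr fun y => ?_
  simp only [Set.domRestrict_apply, hE]
  rfl

end MetricField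

/-! ### Gluing isometries over the probability space -/

namespace ContinuumProduct

variable {Ω : Type w} [MeasurableSpace Ω] {μ : Measure Ω} {F : Type v} [MetricSpace F]
  {X : Type v'} [MetricSpace X] [SecondCountableTopology X]

theorem aestronglyMeasurable_glue {i : Ω → ℕ} (hi : Measurable i) {e : ℕ → F → X}
    (he : ∀ n, Continuous (e n)) (ξ : ContinuumProduct μ F) :
    AEStronglyMeasurable (fun ω => e (i ω) (ξ.1 ω)) μ := by
  borelize F
  borelize X
  have h : Measurable fun q : F × ℕ => e q.2 q.1 :=
    measurable_from_prod_countable_left fun n => (he n).measurable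
  exact (h.comp (ξ.1.stronglyMeasurable.measurable.prodMk hi)).aestronglyMeasurable

variable [IsFiniteMeasure μ]

theorem memLp_glue {i : Ω → ℕ} (hi : Measurable i) {N : ℕ} (hN : ∀ ω, i ω ≤ N) {e : ℕ → F → X}
    (he : ∀ n, Isometry (e n)) (ξ : ContinuumProduct μ F) (x₀ : X) :
    MemLp (fun ω => dist (e (i ω) (ξ.1 ω)) x₀) 2 μ := by
  obtain ⟨a, -⟩ := ξ.2
  refine ((memLp_dist_left ξ a).add
    (memLp_const (∑ n ∈ Finset.range (N + 1), dist (e n a) x₀))).mono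
    ((aestronglyMeasurable_glue hi (fun n => (he n).continuous) ξ).dist aestronglyMeasurable_const)
    (Eventually.of_forall fun ω => ?_)
  simp only [Pi.add_apply, Real.norm_eq_abs]
  rw [abs_of_nonneg dist_nonneg,
    abs_of_nonneg (add_nonneg dist_nonneg (Finset.sum_nonneg fun n _ => dist_nonneg))]
  refine (dist_triangle _ (e (i ω) a) _).trans ?_
  rw [(he _).dist_eq]
  gcongr
  exact Finset.single_le_sum (f := fun n => dist (e n a) x₀) (fun n _ => dist_nonneg)
    (Finset.mem_range.2 (Nat.lt_succ_of_le (hN ω)))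

/-- A bounded measurable choice `i ω` among countably many bijective isometries `e n` of `F` onto
`X` induces a bijective isometry between the `L²`-spaces, which applies `e (i ω)` at the point
`ω`. -/
theorem exists_glue [SecondCountableTopology F] {i : Ω → ℕ} (hi : Measurable i) {N : ℕ}
    (hN : ∀ ω, i ω ≤ N) (e : ℕ → F ≃ᵢ X) :
    ∃ Φ : ContinuumProduct μ F ≃ᵢ ContinuumProduct μ X,
      ∀ ξ, (Φ ξ).1 =ᵐ[μ] fun ω => e (i ω) (ξ.1 ω) := by
  have key : ∀ ξ : ContinuumProduct μ F, ∃ η : ContinuumProduct μ X,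
      η.1 =ᵐ[μ] fun ω => e (i ω) (ξ.1 ω) := fun ξ => by
    obtain ⟨a, -⟩ := ξ.2
    exact ⟨_, coeFn_mk _ (aestronglyMeasurable_glue hi (fun n => (e n).continuous) ξ) (e 0 a)
      (memLp_glue hi hN (fun n => (e n).isometry) ξ _)⟩
  have key' : ∀ η : ContinuumProduct μ X, ∃ ξ : ContinuumProduct μ F,
      ξ.1 =ᵐ[μ] fun ω => (e (i ω)).symm (η.1 ω) := fun η => by
    obtain ⟨a, -⟩ := η.2
    exact ⟨_, coeFn_mk _
      (aestronglyMeasurable_glue hi (fun n => (e n).symm.continuous) η) ((e 0).symm a)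
      (memLp_glue hi hN (fun n => (e n).symm.isometry) η _)⟩
  choose Φ hΦ using key
  choose Ψ hΨ using key'
  refine ⟨IsometryEquiv.mk' Φ Ψ (fun η => ?_) (Isometry.of_dist_eq fun ξ η => ?_), hΦ⟩
  · ext
    filter_upwards [hΦ (Ψ η), hΨ η] with ω h1 h2
    rw [h1, h2, IsometryEquiv.apply_symm_apply]
  · rw [dist_def, dist_def]
    congr 1
    refine integral_congr_ae ?_
    filter_upwards [hΦ ξ, hΦ η] with ω h1 h2
    rw [h1, h2, (e _).dist_eq]

end ContinuumProduct

/-! ### Atlases with bump functions -/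

namespace MetricField

variable {Z : Type u} [TopologicalSpace Z]

/-- Countably many local trivializations `chart n` of the field `C` over open sets `dom n`, together
with bump functions supported in these sets, such that every point of the base space has a
neighborhood on which one of the bump functions equals `1`. -/
structure BumpAtlas (C : MetricField.{u, v} Z) (X : Type v') [MetricSpace X] where
  chart : ℕ → ∀ z, C.fiber z ≃ᵢ X
  dom : ℕ → Set Z
  isOpen_dom : ∀ n, IsOpen (dom n)
  trivializesOn : ∀ n, C.TrivializesOn (chart n) (dom n)
  bump : ℕ → Z → ℝ
  continuous_bump : ∀ n, Continuous (bump n)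
  tsupport_bump : ∀ n, tsupport (bump n) ⊆ dom n
  exists_bump_eq_one : ∀ z, ∃ n, ∀ᶠ z' in 𝓝 z, bump n z' = 1

theorem exists_bumpAtlas [Nonempty Z] [LocallyCompactSpace Z] [T2Space Z]
    [SecondCountableTopology Z] {C : MetricField.{u, v} Z} (h : C.IsLocallyTrivial)
    (hC : MutuallyCocontinuous C.cont) {X : Type v'} [MetricSpace X]
    (hX : ∀ z, Nonempty (C.fiber z ≃ᵢ X)) : Nonempty (C.BumpAtlas X) := by
  choose e U hU hmem htriv using h.exists_trivializesOn hC hX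
  have hbump : ∀ z, ∃ f : Z → ℝ, Continuous f ∧ tsupport f ⊆ U z ∧ ∀ᶠ z' in 𝓝 z, f z' = 1 := by
    intro z
    obtain ⟨K, hK, hzK, hKU⟩ := exists_compact_subset (hU z) (hmem z)
    obtain ⟨L, hL, hKL, hLU⟩ := exists_compact_between hK (hU z) hKU
    obtain ⟨f, hf1, hf0, -, -⟩ := exists_continuous_one_zero_of_isCompact hK
      isOpen_interior.isClosed_compl (disjoint_compl_right_iff_subset.2 hKL)
    refine ⟨f, f.continuous, (closure_minimal ?_ hL.isClosed).trans hLU, ?_⟩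
    · intro y hy
      by_contra hyL
      exact hy (hf0 fun hy' => hyL (interior_subset hy'))
    · filter_upwards [mem_interior_iff_mem_nhds.1 hzK] with y hy
      exact hf1 hy
  choose f hfc hft hf1 using hbump
  obtain ⟨S, hS, hcover⟩ := TopologicalSpace.countable_cover_nhds
    (f := fun z => {y | ∀ᶠ z' in 𝓝 y, f z z' = 1}) fun z => eventually_eventually_nhds.2 (hf1 z)
  have hne : S.Nonempty := by
    obtain ⟨z⟩ := ‹Nonempty Z›
    obtain ⟨y, hy, -⟩ := mem_iUnion₂.1 (hcover.symm ▸ mem_univ z)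
    exact ⟨y, hy⟩
  obtain ⟨c, rfl⟩ := hS.exists_eq_range hne
  refine ⟨⟨fun n => e (c n), fun n => U (c n), fun n => hU _, fun n => htriv _, fun n => f (c n),
    fun n => hfc _, fun n => hft _, fun z => ?_⟩⟩
  obtain ⟨_, ⟨n, rfl⟩, hy⟩ := mem_iUnion₂.1 (hcover.symm ▸ mem_univ z)
  exact ⟨n, hy⟩

namespace BumpAtlas

variable {C : MetricField.{u, v} Z} {X : Type v'} [MetricSpace X] (A : C.BumpAtlas X)

theorem mem_dom {n : ℕ} {z : Z} (h : A.bump n z ≠ 0) : z ∈ A.dom n :=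
  A.tsupport_bump n (subset_tsupport _ h)

theorem exists_mem_dom (z : Z) : ∃ n, z ∈ A.dom n := by
  obtain ⟨n, hn⟩ := A.exists_bump_eq_one z
  exact ⟨n, A.mem_dom (by rw [hn.self_of_nhds]; exact one_ne_zero)⟩

/-- The index of the chart selected over `z` by the random number `x`: the least `n` with
`x < bump n z`. Such an `n` exists for `x < 1`; otherwise the value is irrelevant. -/
noncomputable def index (x : ℝ) (z : Z) : ℕ := sInf {n | x < A.bump n z}

variable {x : ℝ} {z : Z}

theorem lt_bump_index (hx : x < 1) (z : Z) : x < A.bump (A.index x z) z := by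
  obtain ⟨n, hn⟩ := A.exists_bump_eq_one z
  exact Nat.sInf_mem (s := {n | x < A.bump n z}) ⟨n, by simpa [hn.self_of_nhds] using hx⟩

theorem index_le {n : ℕ} (h : x < A.bump n z) : A.index x z ≤ n := Nat.sInf_le h

theorem measurable_index {Ω : Type w} [MeasurableSpace Ω] {r : Ω → ℝ} (hr : Measurable r)
    (hr1 : ∀ ω, r ω < 1) (z : Z) : Measurable fun ω => A.index (r ω) z := by
  refine measurable_of_Iic fun n => ?_
  have : (fun ω => A.index (r ω) z) ⁻¹' Iic n = ⋃ m ∈ Iic n, r ⁻¹' Iio (A.bump m z) := by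
    ext ω
    simp only [mem_preimage, mem_Iic, mem_iUnion, mem_Iio, exists_prop]
    exact ⟨fun h => ⟨_, h, A.lt_bump_index (hr1 ω) z⟩,
      fun ⟨m, hm, h⟩ => (A.index_le h).trans hm⟩
  rw [this]
  exact MeasurableSet.biUnion (to_countable _) fun m _ => hr measurableSet_Iio

/-- Away from the values of the bump functions at `z`, the selected index is locally constant. -/
theorem eventually_index_eq (hx : x < 1) (hne : ∀ n, x ≠ A.bump n z) :
    ∀ᶠ z' in 𝓝 z, A.index x z' = A.index x z := by
  have h1 : ∀ᶠ z' in 𝓝 z, x < A.bump (A.index x z) z' :=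
    (A.continuous_bump _).continuousAt.eventually_const_lt (A.lt_bump_index hx z)
  have h2 : ∀ᶠ z' in 𝓝 z, ∀ n ∈ Finset.range (A.index x z), A.bump n z' < x := by
    rw [Filter.eventually_all_finset]
    intro n hn
    refine (A.continuous_bump n).continuousAt.eventually_lt_const (lt_of_le_of_ne ?_ (hne n).symm)
    exact not_lt.1 fun h => (A.index_le h).not_gt (Finset.mem_range.1 hn)
  filter_upwards [h1, h2] with z' h1 h2
  refine le_antisymm (A.index_le h1) (not_lt.1 fun h => ?_)
  exact (h2 _ (Finset.mem_range.2 h)).not_gt (A.lt_bump_index hx z')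

/-- Locally uniformly on the base space, only finitely many charts are selected. -/
theorem exists_eventually_index_le (z : Z) : ∃ N, ∀ᶠ z' in 𝓝 z, ∀ x < 1, A.index x z' ≤ N := by
  obtain ⟨N, hN⟩ := A.exists_bump_eq_one z
  refine ⟨N, hN.mono fun z' h x hx => A.index_le ?_⟩
  rwa [h]

end BumpAtlas

end MetricField

/-! ### Random charts -/

namespace MetricField.BumpAtlas

variable {Z : Type u} [TopologicalSpace Z] {C : MetricField.{u, v} Z}
  {X : Type v'} [MetricSpace X] (A : C.BumpAtlas X)

/-- Applying the charts selected by `r` pointwise gives bijective isometries from the fibers of the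
randomization onto `L²(Ω, μ, X)`. -/
theorem exists_randomChart {Ω : Type w} [MeasurableSpace Ω] {μ : Measure Ω} {r : Ω → ℝ}
    [IsFiniteMeasure μ] [SecondCountableTopology X]
    (hF : ∀ z, SecondCountableTopology (C.fiber z)) (hr : Measurable r) (hr1 : ∀ ω, r ω < 1) :
    ∃ Φ : ∀ z, ContinuumProduct μ (C.fiber z) ≃ᵢ ContinuumProduct μ X, ∀ z ξ,
      (Φ z ξ).1 =ᵐ[μ] fun ω => A.chart (A.index (r ω) z) z (ξ.1 ω) := by
  choose N hN using A.exists_eventually_index_le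
  choose Φ hΦ using fun z => ContinuumProduct.exists_glue (μ := μ)
    (A.measurable_index hr hr1 z) (fun ω => (hN z).self_of_nhds (r ω) (hr1 ω))
    (fun n => A.chart n z)
  exact ⟨Φ, hΦ⟩

variable {Ω : Type w} [TopologicalSpace Ω]

/-- The continuous sections of the extension of `C` over `Z × Ω` are those that are continuous in
the charts. -/
theorem mem_cont_pullback_fst_iff
    (hd : ∀ z, Dense ((fun s : ∀ z, C.fiber z => s z) '' C.cont))
    (s : ∀ p : Z × Ω, C.fiber p.1) :
    s ∈ (C.pullback (Prod.fst : Z × Ω → Z)).cont ↔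
      ∀ n, ∀ p : Z × Ω, p.1 ∈ A.dom n → ContinuousAt (fun p => A.chart n p.1 (s p)) p := by
  have hsec : ∀ t ∈ C.cont, ∀ n, ∀ p : Z × Ω, p.1 ∈ A.dom n →
      ContinuousAt (fun p => A.chart n p.1 (t p.1)) p := fun t ht n p hp =>
    ContinuousAt.comp (f := Prod.fst) (g := fun z => A.chart n z (t z))
      ((A.trivializesOn n t ht).continuousAt ((A.isOpen_dom n).mem_nhds hp)) continuousAt_fst
  constructor
  · intro hs n p hp
    refine continuousAt_of_dense (C := C.pullback (Prod.fst : Z × Ω → Z))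
      (fun p => A.chart n p.1)
      (S := (fun (s : ∀ z, C.fiber z) (p : Z × Ω) => s p.1) '' C.cont) ?_ ?_ ?_
    · rintro _ ⟨t, ht, rfl⟩
      exact hsec t ht n p hp
    · refine (hd p.1).mono ?_
      rintro _ ⟨t, ht, rfl⟩
      exact ⟨_, ⟨t, ht, rfl⟩, rfl⟩
    · intro t ht
      exact (hs s (mem_insert _ _) t (mem_insert_of_mem _ ht)).continuousAt
  · intro hs
    have hall : ∀ t ∈ insert s ((fun (s : ∀ z, C.fiber z) (p : Z × Ω) => s p.1) '' C.cont), ∀ n,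
        ∀ p : Z × Ω, p.1 ∈ A.dom n → ContinuousAt (fun p => A.chart n p.1 (t p)) p := by
      rintro t (rfl | ⟨t, ht, rfl⟩)
      exacts [hs, hsec t ht]
    intro t ht t' ht'
    refine continuous_iff_continuousAt.2 fun p => ?_
    obtain ⟨n, hn⟩ := A.exists_mem_dom p.1
    have h : ContinuousAt
        (fun q : Z × Ω => dist (A.chart n q.1 (t q)) (A.chart n q.1 (t' q))) p :=
      (hall t ht n p hn).dist (hall t' ht' n p hn)
    exact h.congr (Eventually.of_forall fun q => (A.chart n q.1).dist_eq _ _)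

variable {r : Ω → ℝ}

/-- In the selected charts, a continuous section over `Z × Ω` is bounded near each point of `Z`;
this provides the bound for dominated convergence. -/
theorem exists_eventually_dist_le [CompactSpace Ω] [LocallyCompactSpace Z] (hr0 : ∀ ω, 0 ≤ r ω)
    (hr1 : ∀ ω, r ω < 1) {s : ∀ p : Z × Ω, C.fiber p.1}
    (hs : ∀ n, ∀ p : Z × Ω, p.1 ∈ A.dom n → ContinuousAt (fun p => A.chart n p.1 (s p)) p)
    (x₀ : X) (z₀ : Z) :
    ∃ M, ∀ᶠ z in 𝓝 z₀, ∀ ω, dist (A.chart (A.index (r ω) z) z (s (z, ω))) x₀ ≤ M := by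
  obtain ⟨N, hN⟩ := A.exists_eventually_index_le z₀
  -- Near `z₀`, chart `n` is either never selected, or bounded on `s` by compactness of `Ω`.
  have hbound : ∀ n, ∃ M, 0 ≤ M ∧ ∀ᶠ z in 𝓝 z₀, ∀ ω, r ω < A.bump n z →
      dist (A.chart n z (s (z, ω))) x₀ ≤ M := by
    intro n
    by_cases hz : z₀ ∈ tsupport (A.bump n)
    · obtain ⟨K, hK, hzK, hKU⟩ := exists_compact_subset (A.isOpen_dom n) (A.tsupport_bump n hz)
      have hcont : ContinuousOn (fun p : Z × Ω => dist (A.chart n p.1 (s p)) x₀)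
          (K ×ˢ (univ : Set Ω)) := fun p hp => by
        have h : ContinuousAt (fun p : Z × Ω => dist (A.chart n p.1 (s p)) x₀) p :=
          (hs n p (hKU hp.1)).dist continuousAt_const
        exact h.continuousWithinAt
      obtain ⟨M, hM⟩ := (hK.prod isCompact_univ).exists_bound_of_continuousOn hcont
      refine ⟨max M 0, le_max_right _ _, ?_⟩
      filter_upwards [mem_interior_iff_mem_nhds.1 hzK] with z hzK ω _
      exact (le_abs_self _).trans ((hM (z, ω) ⟨hzK, mem_univ _⟩).trans (le_max_left _ _))
    · refine ⟨0, le_rfl, ?_⟩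
      filter_upwards [(isClosed_tsupport _).isOpen_compl.mem_nhds hz] with z hz ω hω
      rw [image_eq_zero_of_notMem_tsupport hz] at hω
      exact absurd hω (hr0 ω).not_gt
  choose M hM0 hM using hbound
  refine ⟨∑ n ∈ Finset.range (N + 1), M n, ?_⟩
  filter_upwards [hN, (Filter.eventually_all_finset (Finset.range (N + 1))).2 fun n _ => hM n]
    with z h1 h2 ω
  have hmem : A.index (r ω) z ∈ Finset.range (N + 1) :=
    Finset.mem_range.2 (Nat.lt_succ_of_le (h1 _ (hr1 ω)))
  exact (h2 _ hmem ω (A.lt_bump_index (hr1 ω) z)).trans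
    (Finset.single_le_sum (fun n _ => hM0 n) hmem)

variable [MeasurableSpace Ω] {μ : Measure Ω}

/-- The random charts are continuous: as `z` varies, the selected chart changes only on a set of
small measure, because `r` has no atoms. -/
theorem continuous_randomChart [CompactSpace Ω] [LocallyCompactSpace Z]
    [FirstCountableTopology Z] [IsFiniteMeasure μ]
    (hr0 : ∀ ω, 0 ≤ r ω) (hr1 : ∀ ω, r ω < 1) (hra : ∀ c, μ {ω | r ω = c} = 0)
    {Φ : ∀ z, ContinuumProduct μ (C.fiber z) ≃ᵢ ContinuumProduct μ X}
    (hΦ : ∀ z ξ, (Φ z ξ).1 =ᵐ[μ] fun ω => A.chart (A.index (r ω) z) z (ξ.1 ω))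
    {s : ∀ p : Z × Ω, C.fiber p.1}
    (hs : ∀ n, ∀ p : Z × Ω, p.1 ∈ A.dom n → ContinuousAt (fun p => A.chart n p.1 (s p)) p)
    {σ : ∀ z, ContinuumProduct μ (C.fiber z)} (hσ : ∀ z, (σ z).1 =ᵐ[μ] fun ω => s (z, ω)) :
    Continuous fun z => Φ z (σ z) := by
  refine continuous_iff_continuousAt.2 fun z₀ => ?_
  obtain ⟨x₀, -⟩ := (Φ z₀ (σ z₀)).2
  let g : Z → Ω → X := fun z ω => A.chart (A.index (r ω) z) z (s (z, ω))
  have hg : ∀ z, (Φ z (σ z)).1 =ᵐ[μ] g z := fun z => by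
    filter_upwards [hΦ z (σ z), hσ z] with ω h1 h2
    rw [h1, h2]
  have hgd : ∀ z, (fun ω => dist ((Φ z (σ z)).1 ω) ((Φ z₀ (σ z₀)).1 ω) ^ 2) =ᵐ[μ]
      fun ω => dist (g z ω) (g z₀ ω) ^ 2 := fun z => by
    filter_upwards [hg z, hg z₀] with ω h1 h2
    rw [h1, h2]
  obtain ⟨M, hM⟩ := A.exists_eventually_dist_le hr0 hr1 hs x₀ z₀
  have hae : ∀ᵐ ω ∂μ, ∀ n, r ω ≠ A.bump n z₀ := by
    rw [ae_all_iff]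
    intro n
    simpa [ae_iff] using hra (A.bump n z₀)
  have hint : Tendsto (fun z => ∫ ω, dist (g z ω) (g z₀ ω) ^ 2 ∂μ) (𝓝 z₀) (𝓝 0) := by
    have h := tendsto_integral_filter_of_dominated_convergence (μ := μ) (l := 𝓝 z₀)
      (F := fun z ω => dist (g z ω) (g z₀ ω) ^ 2) (f := fun _ => (0 : ℝ))
      (fun _ => (M + M) ^ 2) ?_ ?_ (integrable_const _) ?_
    · simpa using h
    · exact Eventually.of_forall fun z =>
        (ContinuumProduct.integrable_dist_sq _ _).aestronglyMeasurable.congr (hgd z)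
    · filter_upwards [hM] with z hz
      refine Eventually.of_forall fun ω => ?_
      rw [Real.norm_eq_abs, abs_of_nonneg (sq_nonneg _)]
      refine pow_le_pow_left₀ dist_nonneg ((dist_triangle_right _ _ x₀).trans ?_) 2
      exact add_le_add (hz ω) (hM.self_of_nhds ω)
    · filter_upwards [hae] with ω hω
      have hidx := A.eventually_index_eq (hr1 ω) hω
      have hdom : z₀ ∈ A.dom (A.index (r ω) z₀) :=
        A.mem_dom ((hr0 ω).trans_lt (A.lt_bump_index (hr1 ω) z₀)).ne'
      have hc : ContinuousAt (fun z => A.chart (A.index (r ω) z₀) z (s (z, ω))) z₀ :=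
        ContinuousAt.comp (f := fun z => (z, ω))
          (g := fun p : Z × Ω => A.chart (A.index (r ω) z₀) p.1 (s p)) (hs _ (z₀, ω) hdom)
          (by fun_prop)
      have hg0 : Tendsto (fun z => g z ω) (𝓝 z₀) (𝓝 (g z₀ ω)) := by
        refine Tendsto.congr' ?_ hc
        filter_upwards [hidx] with z hz
        simp only [g, hz]
      have := (tendsto_iff_dist_tendsto_zero.1 hg0).pow 2
      simpa using this
  rw [ContinuousAt, tendsto_iff_dist_tendsto_zero]
  have := hint.sqrt
  rw [Real.sqrt_zero] at this
  refine this.congr fun z => ?_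
  rw [ContinuumProduct.dist_def, integral_congr_ae (hgd z)]

end MetricField.BumpAtlas

/-! ### Density of continuous sections in the randomization -/

theorem IsometryEquiv.apply_geo {F : Type*} [MetricSpace F] {X : Type*} [MetricSpace X]
    (e : F ≃ᵢ X) (hF : IsGeodesicSpace F) (hX : IsGeodesicSpace X) (hc : IsCAT0 X) (x y : F)
    {t : ℝ} (ht : t ∈ Icc (0 : ℝ) 1) : e (hF.geo x y t) = hX.geo (e x) (e y) t := by
  refine IsGeodesicSpace.eq_geo_of_dist hc ht ?_ ?_
  · rw [e.dist_eq, e.dist_eq, hF.dist_left_geo _ _ ht]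
  · rw [e.dist_eq, e.dist_eq, hF.dist_geo_right _ _ ht]

/-- Simple functions are dense in `L²(Ω, μ, F)`. -/
theorem ContinuumProduct.exists_simpleFunc_eLpNorm_dist_lt {Ω : Type w} [MeasurableSpace Ω]
    {μ : Measure Ω} [IsFiniteMeasure μ] {F : Type v} [MetricSpace F] [SecondCountableTopology F]
    (ξ : ContinuumProduct μ F) {ε : ℝ≥0∞} (hε : ε ≠ 0) :
    ∃ f : SimpleFunc Ω F, eLpNorm (fun ω => dist (ξ.1 ω) (f ω)) 2 μ < ε := by
  borelize F
  obtain ⟨a, -⟩ := ξ.2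
  have hm : Measurable ξ.1 := ξ.1.stronglyMeasurable.measurable
  let f := SimpleFunc.approxOn (ξ.1 : Ω → F) hm univ a (mem_univ a)
  have hle : ∀ n ω, dist (ξ.1 ω) (f n ω) ≤ dist (ξ.1 ω) a := fun n ω => by
    have := SimpleFunc.edist_approxOn_le hm (mem_univ a) ω n
    rwa [edist_dist, edist_dist, ENNReal.ofReal_le_ofReal_iff dist_nonneg, dist_comm, dist_comm a]
      at this
  have hmeas : ∀ n, AEStronglyMeasurable (fun ω => dist (ξ.1 ω) (f n ω)) μ := fun n =>
    ξ.1.aestronglyMeasurable.dist (f n).aestronglyMeasurable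
  have hmem : ∀ n, MemLp (fun ω => dist (ξ.1 ω) (f n ω)) 2 μ := fun n =>
    (memLp_dist_left ξ a).mono (hmeas n) (Eventually.of_forall fun ω => by
      rw [Real.norm_eq_abs, Real.norm_eq_abs, abs_of_nonneg dist_nonneg, abs_of_nonneg dist_nonneg]
      exact hle n ω)
  have hlim : Tendsto (fun n => ∫ ω, dist (ξ.1 ω) (f n ω) ^ 2 ∂μ) atTop (𝓝 0) := by
    have h := tendsto_integral_of_dominated_convergence (μ := μ)
      (F := fun n ω => dist (ξ.1 ω) (f n ω) ^ 2) (f := fun _ => (0 : ℝ))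
      (fun ω => dist (ξ.1 ω) a ^ 2) (fun n => (hmeas n).pow 2)
      (memLp_dist_left ξ a).integrable_sq (fun n => Eventually.of_forall fun ω => by
        rw [Real.norm_eq_abs, abs_of_nonneg (sq_nonneg _)]
        exact pow_le_pow_left₀ dist_nonneg (hle n ω) 2)
      (Eventually.of_forall fun ω => by
        have h := (SimpleFunc.tendsto_approxOn hm (mem_univ a) (x := ω) (by simp))
        have h' := (tendsto_iff_dist_tendsto_zero.1 h).pow 2
        simpa [dist_comm] using h')
    simpa using h
  have hlim' : Tendsto (fun n => eLpNorm (fun ω => dist (ξ.1 ω) (f n ω)) 2 μ) atTop (𝓝 0) := by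
    have h := ENNReal.tendsto_ofReal hlim.sqrt
    rw [Real.sqrt_zero, ENNReal.ofReal_zero] at h
    refine h.congr fun n => ?_
    rw [(hmem n).eLpNorm_eq_integral_rpow_norm (by norm_num) (by norm_num), Real.sqrt_eq_rpow]
    norm_num
  obtain ⟨n, hn⟩ := (hlim'.eventually_lt_const (pos_iff_ne_zero.2 hε)).exists
  exact ⟨f n, hn⟩

/-- A measurable set is approximated by continuous functions to `[0,1]`. -/
theorem MeasurableSet.exists_continuous_eLpNorm_indicator_sub_le {Ω : Type w}
    [TopologicalSpace Ω] [CompactSpace Ω] [T2Space Ω] [SecondCountableTopology Ω]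
    [MeasurableSpace Ω] [BorelSpace Ω] {μ : Measure Ω} [IsFiniteMeasure μ] {S : Set Ω}
    (hS : MeasurableSet S) {ε : ℝ≥0∞} (hε : ε ≠ 0) :
    ∃ χ : Ω → ℝ, Continuous χ ∧ (∀ ω, χ ω ∈ Icc (0 : ℝ) 1) ∧
      eLpNorm (fun ω => S.indicator (fun _ => (1 : ℝ)) ω - χ ω) 2 μ ≤ ε := by
  have hmem : MemLp (S.indicator fun _ => (1 : ℝ)) 2 μ := (memLp_const 1).indicator hS
  obtain ⟨g, hg, -⟩ := hmem.exists_boundedContinuous_eLpNorm_sub_le (by norm_num) hε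
  refine ⟨fun ω => max 0 (min 1 (g ω)), by fun_prop,
    fun ω => ⟨le_max_left _ _, max_le zero_le_one (min_le_left _ _)⟩,
    (eLpNorm_mono fun ω => ?_).trans hg⟩
  rw [Real.norm_eq_abs, Real.norm_eq_abs, Pi.sub_apply]
  by_cases hω : ω ∈ S
  · rw [indicator_of_mem hω, abs_of_nonneg]
    · refine le_trans (sub_le_sub_left (le_max_right _ _) _) (le_trans (b := |1 - min 1 (g ω)|)
        (le_abs_self _) ?_)
      rcases le_total (g ω) 1 with h | h
      · rw [min_eq_right h]
      · rw [min_eq_left h, sub_self, abs_zero]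
        exact abs_nonneg _
    · exact sub_nonneg.2 (max_le zero_le_one (min_le_left _ _))
  · rw [indicator_of_notMem hω, zero_sub, zero_sub, abs_neg, abs_neg,
      abs_of_nonneg (le_max_left _ _)]
    exact max_le (abs_nonneg _) ((min_le_right _ _).trans (le_abs_self _))

/-- Continuous approximations of two simple functions are mixed to a continuous approximation of the
simple function that agrees with one of them on a measurable set and with the other one outside. -/
theorem exists_eLpNorm_dist_piecewise_geo_le {Ω : Type w} [TopologicalSpace Ω] [CompactSpace Ω]
    [T2Space Ω] [SecondCountableTopology Ω] [MeasurableSpace Ω] [BorelSpace Ω] {μ : Measure Ω}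
    [IsFiniteMeasure μ] {F : Type v} [MetricSpace F] (hG : IsGeodesicSpace F)
    {f g : SimpleFunc Ω F} {S : Set Ω} (hS : MeasurableSet S) {a b : Ω → F} (ha : Continuous a)
    (hb : Continuous b) {ε : ℝ} (hε : 0 < ε)
    (hfa : eLpNorm (fun ω => dist (f ω) (a ω)) 2 μ ≤ ENNReal.ofReal (ε / 3))
    (hgb : eLpNorm (fun ω => dist (g ω) (b ω)) 2 μ ≤ ENNReal.ofReal (ε / 3)) :
    ∃ χ : Ω → ℝ, Continuous χ ∧ (∀ ω, χ ω ∈ Icc (0 : ℝ) 1) ∧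
      eLpNorm (fun ω => dist (f.piecewise S hS g ω) (hG.geo (b ω) (a ω) (χ ω))) 2 μ ≤
        ENNReal.ofReal ε := by
  obtain ⟨M, hM⟩ := isCompact_univ.exists_bound_of_continuousOn (hb.dist ha).continuousOn
  obtain ⟨δ, hδ, hδM⟩ : ∃ δ > 0, δ * max M 0 ≤ ε / 3 := by
    refine ⟨ε / 3 / (max M 0 + 1), by positivity, ?_⟩
    rw [div_mul_eq_mul_div, div_le_iff₀ (by positivity)]
    nlinarith [le_max_right M 0]
  obtain ⟨χ, hχ, hχ01, hχS⟩ := hS.exists_continuous_eLpNorm_indicator_sub_le (μ := μ)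
    (ε := ENNReal.ofReal δ) (by simpa using hδ)
  refine ⟨χ, hχ, hχ01, ?_⟩
  let D : Ω → ℝ := fun ω => max M 0 * |S.indicator (fun _ => (1 : ℝ)) ω - χ ω|
  have hpt : ∀ ω, dist (f.piecewise S hS g ω) (hG.geo (b ω) (a ω) (χ ω)) ≤
      dist (f ω) (a ω) + dist (g ω) (b ω) + D ω := fun ω => by
    have hM' : dist (b ω) (a ω) ≤ max M 0 :=
      (le_abs_self _).trans ((hM ω (mem_univ ω)).trans (le_max_left _ _))
    simp only [D]
    by_cases hω : ω ∈ S
    · have h1 := hG.dist_geo_right (b ω) (a ω) (hχ01 ω)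
      rw [SimpleFunc.piecewise_apply, if_pos hω, indicator_of_mem hω,
        abs_of_nonneg (by linarith [(hχ01 ω).2])]
      have h2 := dist_triangle_right (f ω) (hG.geo (b ω) (a ω) (χ ω)) (a ω)
      rw [h1] at h2
      have h3 := mul_le_mul_of_nonneg_right hM' (show 0 ≤ 1 - χ ω by linarith [(hχ01 ω).2])
      linarith [dist_nonneg (x := g ω) (y := b ω)]
    · have h1 := hG.dist_left_geo (b ω) (a ω) (hχ01 ω)
      rw [SimpleFunc.piecewise_apply, if_neg hω, indicator_of_notMem hω, zero_sub, abs_neg,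
        abs_of_nonneg (hχ01 ω).1]
      have h2 := dist_triangle (g ω) (b ω) (hG.geo (b ω) (a ω) (χ ω))
      rw [h1] at h2
      have h3 := mul_le_mul_of_nonneg_right hM' (hχ01 ω).1
      linarith [dist_nonneg (x := f ω) (y := a ω)]
  have hm1 : AEStronglyMeasurable (fun ω => dist (f ω) (a ω)) μ :=
    f.aestronglyMeasurable.dist ha.aestronglyMeasurable
  have hm2 : AEStronglyMeasurable (fun ω => dist (g ω) (b ω)) μ :=
    g.aestronglyMeasurable.dist hb.aestronglyMeasurable
  have hmI : AEStronglyMeasurable (fun ω => S.indicator (fun _ => (1 : ℝ)) ω - χ ω) μ :=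
    (aestronglyMeasurable_const.indicator hS).sub hχ.aestronglyMeasurable
  have hmD : AEStronglyMeasurable D μ := hmI.norm.const_mul _
  have hD : eLpNorm D 2 μ ≤ ENNReal.ofReal (ε / 3) := by
    refine (eLpNorm_le_mul_eLpNorm_of_ae_le_mul (c := max M 0)
      (g := fun ω => S.indicator (fun _ => (1 : ℝ)) ω - χ ω)
      (Eventually.of_forall fun ω => ?_) 2).trans ?_
    · simp only [D, norm_mul, Real.norm_eq_abs, abs_abs, abs_of_nonneg (le_max_right M 0), le_refl]
    · refine (mul_le_mul_right hχS _).trans ?_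
      rw [← ENNReal.ofReal_mul (le_max_right _ _), mul_comm]
      exact ENNReal.ofReal_le_ofReal hδM
  calc eLpNorm (fun ω => dist (f.piecewise S hS g ω) (hG.geo (b ω) (a ω) (χ ω))) 2 μ
      ≤ eLpNorm ((fun ω => dist (f ω) (a ω)) + (fun ω => dist (g ω) (b ω)) + D) 2 μ := by
        refine eLpNorm_mono_real fun ω => ?_
        rw [Real.norm_eq_abs, abs_of_nonneg dist_nonneg]
        exact hpt ω
    _ ≤ ENNReal.ofReal (ε / 3) + ENNReal.ofReal (ε / 3) + ENNReal.ofReal (ε / 3) := by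
        refine (eLpNorm_add_le (hm1.add hm2) hmD (by norm_num)).trans (add_le_add ?_ hD)
        exact (eLpNorm_add_le hm1 hm2 (by norm_num)).trans (add_le_add hfa hgb)
    _ = ENNReal.ofReal ε := by
        rw [← ENNReal.ofReal_add (by positivity) (by positivity),
          ← ENNReal.ofReal_add (by positivity) (by positivity)]
        congr 1
        ring

namespace MetricField.BumpAtlas

variable {Z : Type u} [TopologicalSpace Z] {C : MetricField.{u, v} Z}
  {X : Type v'} [MetricSpace X] {Ω : Type w} [TopologicalSpace Ω]

/-- Two continuous sections over `Z × Ω` can be mixed along geodesics by a continuous function. -/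
theorem geo_mem_cont_pullback_fst (A : C.BumpAtlas X) (hC : C.IsContinuousField)
    (hX : IsGeodesicSpace X) (hc : IsCAT0 X) {s s' : ∀ p : Z × Ω, C.fiber p.1}
    (hs : s ∈ (C.pullback (Prod.fst : Z × Ω → Z)).cont)
    (hs' : s' ∈ (C.pullback (Prod.fst : Z × Ω → Z)).cont) {χ : Ω → ℝ} (hχ : Continuous χ)
    (hχ01 : ∀ ω, χ ω ∈ Icc (0 : ℝ) 1) :
    (fun p : Z × Ω => (hC.fiber_hilbertHadamard p.1).geodesic.geo (s p) (s' p) (χ p.2)) ∈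
      (C.pullback (Prod.fst : Z × Ω → Z)).cont := by
  rw [A.mem_cont_pullback_fst_iff hC.dense] at hs hs' ⊢
  intro n p hp
  have hpt : (fun p : Z × Ω => A.chart n p.1
      ((hC.fiber_hilbertHadamard p.1).geodesic.geo (s p) (s' p) (χ p.2))) =
      fun p => hX.geo (A.chart n p.1 (s p)) (A.chart n p.1 (s' p)) (χ p.2) := funext fun q =>
    (A.chart n q.1).apply_geo (hC.fiber_hilbertHadamard q.1).geodesic hX hc _ _ (hχ01 q.2)
  rw [hpt]
  exact IsGeodesicSpace.tendsto_geo hc (hs n p hp) (hs' n p hp)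
    (hχ.comp continuous_snd).continuousAt (Eventually.of_forall fun q => hχ01 q.2) (hχ01 p.2)

theorem continuous_of_mem_cont_pullback_fst (A : C.BumpAtlas X) (hC : C.IsContinuousField)
    {s : ∀ p : Z × Ω, C.fiber p.1} (hs : s ∈ (C.pullback (Prod.fst : Z × Ω → Z)).cont) (z : Z) :
    Continuous (Y := C.fiber z) fun ω => s (z, ω) := by
  rw [A.mem_cont_pullback_fst_iff hC.dense] at hs
  obtain ⟨n, hn⟩ := A.exists_mem_dom z
  let a : Ω → C.fiber z := fun ω => s (z, ω)
  suffices h : Continuous (A.chart n z ∘ a) from (A.chart n z).isometry.comp_continuous_iff.1 h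
  refine continuous_iff_continuousAt.2 fun ω => ?_
  exact ContinuousAt.comp (f := fun ω => (z, ω))
    (g := fun p : Z × Ω => A.chart n p.1 (s p)) (hs n (z, ω) hn) (by fun_prop)

variable [CompactSpace Ω] [SecondCountableTopology Ω] [MeasurableSpace Ω] [BorelSpace Ω]
  {μ : Measure Ω} [IsProbabilityMeasure μ]

/-- Continuous sections over `Z × Ω` are bounded on `{z} × Ω` by compactness of `Ω`, hence define
elements of the fibers of the randomization. -/
theorem exists_coeFn_ae_eq_section (A : C.BumpAtlas X) (hC : C.IsContinuousField)
    {s : ∀ p : Z × Ω, C.fiber p.1} (hs : s ∈ (C.pullback (Prod.fst : Z × Ω → Z)).cont) (z : Z) :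
    ∃ ξ : ContinuumProduct μ (C.fiber z), ξ.1 =ᵐ[μ] fun ω => s (z, ω) := by
  obtain ⟨a⟩ := (hC.fiber_hilbertHadamard z).nonempty
  have hcont := A.continuous_of_mem_cont_pullback_fst hC hs z
  obtain ⟨M, hM⟩ := isCompact_univ.exists_bound_of_continuousOn
    (f := fun ω => dist (s (z, ω)) a) (hcont.dist continuous_const).continuousOn
  exact ⟨_, ContinuumProduct.coeFn_mk (fun ω => s (z, ω)) hcont.aestronglyMeasurable a
    (MemLp.of_bound (hcont.dist continuous_const).aestronglyMeasurable M
      (Eventually.of_forall fun ω => hM ω (mem_univ ω)))⟩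

variable [T2Space Ω]

/-- Every simple function with values in a fiber is approximated by continuous sections over
`Z × Ω`. -/
theorem exists_section_eLpNorm_dist_simpleFunc_le (A : C.BumpAtlas X) (hC : C.IsContinuousField)
    (hX : IsGeodesicSpace X) (hc : IsCAT0 X) (z : Z) (f : SimpleFunc Ω (C.fiber z)) :
    ∀ ε : ℝ, 0 < ε → ∃ s : ∀ p : Z × Ω, C.fiber p.1,
      s ∈ (C.pullback (Prod.fst : Z × Ω → Z)).cont ∧
      eLpNorm (fun ω => dist (f ω) (s (z, ω))) 2 μ ≤ ENNReal.ofReal ε := by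
  have := (hC.fiber_hilbertHadamard z).nonempty
  induction f using SimpleFunc.induction' with
  | const c =>
    intro ε hε
    obtain ⟨_, ⟨t, ht, rfl⟩, hlt⟩ := (hC.dense z).exists_dist_lt c hε
    have hmem : (fun p : Z × Ω => t p.1) ∈ (C.pullback (Prod.fst : Z × Ω → Z)).cont := by
      rw [A.mem_cont_pullback_fst_iff hC.dense]
      exact fun n p hp => ContinuousAt.comp (f := Prod.fst) (g := fun z => A.chart n z (t z))
        ((A.trivializesOn n t ht).continuousAt ((A.isOpen_dom n).mem_nhds hp)) continuousAt_fst
    refine ⟨_, hmem, (eLpNorm_le_of_ae_bound (C := ε) (Eventually.of_forall fun ω => ?_)).trans ?_⟩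
    · rw [Real.norm_eq_abs, abs_of_nonneg dist_nonneg]
      exact hlt.le
    · simp
  | pcw hS hf hg =>
    rename_i f g S
    intro ε hε
    obtain ⟨s, hs, hfs⟩ := hf (ε / 3) (by positivity)
    obtain ⟨s', hs', hgs⟩ := hg (ε / 3) (by positivity)
    obtain ⟨χ, hχ, hχ01, hle⟩ := exists_eLpNorm_dist_piecewise_geo_le
      (hC.fiber_hilbertHadamard z).geodesic hS (A.continuous_of_mem_cont_pullback_fst hC hs z)
      (A.continuous_of_mem_cont_pullback_fst hC hs' z) hε hfs hgs
    exact ⟨_, A.geo_mem_cont_pullback_fst hC hX hc hs' hs hχ hχ01, hle⟩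

/-- The sections of the randomization that come from continuous sections over `Z × Ω` take a dense
set of values in each fiber. -/
theorem dense_sections (A : C.BumpAtlas X) (hC : C.IsContinuousField)
    (hF : ∀ z, SecondCountableTopology (C.fiber z)) (hX : IsGeodesicSpace X) (hc : IsCAT0 X)
    (z : Z) :
    Dense ((fun σ : ∀ z, ContinuumProduct μ (C.fiber z) => σ z) ''
      {σ | ∃ s ∈ (C.pullback (Prod.fst : Z × Ω → Z)).cont,
        ∀ z, (σ z).1 =ᵐ[μ] fun ω => s (z, ω)}) := by
  refine Metric.dense_iff.2 fun ξ ε hε => ?_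
  obtain ⟨f, hf⟩ := ξ.exists_simpleFunc_eLpNorm_dist_lt (ε := ENNReal.ofReal (ε / 2))
    (by simpa using hε)
  obtain ⟨s, hs, hfs⟩ := A.exists_section_eLpNorm_dist_simpleFunc_le (μ := μ) hC hX hc z f (ε / 2)
    (by positivity)
  choose σ hσ using fun z => A.exists_coeFn_ae_eq_section (μ := μ) hC hs z
  refine ⟨σ z, ?_, σ, ⟨s, hs, hσ⟩, rfl⟩
  rw [Metric.mem_ball, dist_comm, ContinuumProduct.dist_eq_eLpNorm]
  refine ENNReal.toReal_lt_of_lt_ofReal ?_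
  have hfσ : eLpNorm (fun ω => dist (f ω) ((σ z).1 ω)) 2 μ ≤ ENNReal.ofReal (ε / 2) := by
    refine (eLpNorm_congr_ae ?_).trans_le hfs
    filter_upwards [hσ z] with ω hω
    rw [hω]
  calc eLpNorm (fun ω => dist (ξ.1 ω) ((σ z).1 ω)) 2 μ
      ≤ eLpNorm ((fun ω => dist (ξ.1 ω) (f ω)) + fun ω => dist (f ω) ((σ z).1 ω)) 2 μ := by
        refine eLpNorm_mono_real fun ω => ?_
        simp only [Real.norm_eq_abs, abs_of_nonneg dist_nonneg]
        exact dist_triangle _ _ _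
    _ ≤ eLpNorm (fun ω => dist (ξ.1 ω) (f ω)) 2 μ +
          eLpNorm (fun ω => dist (f ω) ((σ z).1 ω)) 2 μ :=
        eLpNorm_add_le (ξ.1.aestronglyMeasurable.dist f.aestronglyMeasurable)
          (f.aestronglyMeasurable.dist (σ z).1.aestronglyMeasurable) (by norm_num)
    _ < ENNReal.ofReal (ε / 2) + ENNReal.ofReal (ε / 2) :=
        ENNReal.add_lt_add_of_lt_of_le (hfσ.trans_lt ENNReal.ofReal_lt_top).ne hf hfσ
    _ = ENNReal.ofReal ε := by
        rw [← ENNReal.ofReal_add (by positivity) (by positivity), add_halves]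

end MetricField.BumpAtlas

/-! ### Trivialization of the randomization -/

/-- On an atomless standard probability space there is a random number in `[0,1)` without atoms. -/
theorem exists_measurable_measure_fiber_eq_zero {Ω : Type w} [TopologicalSpace Ω] [CompactSpace Ω]
    [T2Space Ω] [SecondCountableTopology Ω] [MeasurableSpace Ω] [BorelSpace Ω] (μ : Measure Ω)
    [NullSingletonClass μ] :
    ∃ r : Ω → ℝ, Measurable r ∧ (∀ ω, 0 ≤ r ω) ∧ (∀ ω, r ω < 1) ∧
      ∀ c, μ {ω | r ω = c} = 0 := by
  -- A compatible metric makes `Ω` a Polish space, hence a standard Borel space.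
  let _ := TopologicalSpace.metrizableSpaceMetric Ω
  have hinj : Function.Injective fun ω => Real.sigmoid (embeddingReal Ω ω) :=
    Real.sigmoid_strictMono.injective.comp (measurableEmbedding_embeddingReal Ω).injective
  refine ⟨fun ω => Real.sigmoid (embeddingReal Ω ω), ?_, fun ω => (Real.sigmoid_pos _).le,
    fun ω => Real.sigmoid_lt_one _, fun c => ?_⟩
  · exact Real.sigmoid_monotone.measurable.comp (measurableEmbedding_embeddingReal Ω).measurable
  · exact Set.Subsingleton.measure_zero (fun ω hω ω' hω' => hinj (hω.trans hω'.symm)) μ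

/-- The one-point space serves as the fiber of a trivial field over the empty base space. -/
theorem isHilbertHadamard_punit : IsHilbertHadamard PUnit.{v + 1} where
  nonempty := inferInstance
  complete := inferInstance
  geodesic _ _ := ⟨fun _ => PUnit.unit, rfl, rfl, fun _ _ _ _ => by simp⟩
  cat0 _ _ _ _ _ := by simp
  tangentCone p := by
    have : IsEmpty (TangentCone p) := ⟨fun a => by
      obtain ⟨ℓ, hℓ, h⟩ := (a.dir.seq 0).geodesic
      have := h.dist_zero_one
      simp only [dist_self] at this
      exact hℓ.ne this⟩
    exact ⟨PUnit, inferInstance, inferInstance, inferInstance, fun _ => PUnit.unit,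
      fun a => isEmptyElim a⟩

namespace MetricField

variable {Z : Type u} [TopologicalSpace Z]

theorem mutuallyCocontinuous_of_isEmpty [IsEmpty Z] {F : Z → Type v} [∀ z, MetricSpace (F z)]
    (S : Set (∀ z, F z)) : MutuallyCocontinuous S :=
  fun _ _ _ _ => continuous_of_const fun z => isEmptyElim z

theorem isTrivial_of_isEmpty [IsEmpty Z] {C : MetricField.{u, v} Z} (hC : ∀ s, s ∈ C.cont) :
    C.IsTrivial :=
  ⟨PUnit, inferInstance, isHilbertHadamard_punit, isomorphic_const_iff.2
    ⟨fun z => isEmptyElim z, fun s => iff_of_true (hC s)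
      (continuous_of_const fun z => isEmptyElim z)⟩⟩

/-- The randomization of a locally trivial field with fibers isometric to `X` is isomorphic, by the
random charts, to the constant field with fiber `L²(Ω, μ, X)`. -/
theorem isomorphic_continuumPower_const [Nonempty Z] {C : MetricField.{u, v} Z}
    (hC : C.IsContinuousField) (hsc : C.IsSecondCountable) (hlt : C.IsLocallyTrivial)
    {X : Type v'} [MetricSpace X] [SecondCountableTopology X]
    (hX : IsGeodesicSpace X) (hc : IsCAT0 X)
    (hCX : ∀ z, Nonempty (C.fiber z ≃ᵢ X)) {Ω : Type w} [TopologicalSpace Ω] [CompactSpace Ω]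
    [T2Space Ω] [SecondCountableTopology Ω] [MeasurableSpace Ω] [BorelSpace Ω] (μ : Measure Ω)
    [IsProbabilityMeasure μ] [NullSingletonClass μ] :
    Isomorphic (C.continuumPower μ) (const Z (ContinuumProduct μ X)) := by
  have := hC.locallyCompact
  have := hC.hausdorff
  have := hsc.1
  have hF := hsc.2
  obtain ⟨A⟩ := exists_bumpAtlas hlt hC.cocontinuous hCX
  obtain ⟨r, hr, hr0, hr1, hra⟩ := exists_measurable_measure_fiber_eq_zero μ
  obtain ⟨Φ, hΦ⟩ := A.exists_randomChart (μ := μ) hF hr hr1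
  refine isomorphic_const_iff.2 ⟨Φ, fun σ => mem_generatedSections_iff
    (C := C.continuumPower μ) Φ ?_ (A.dense_sections hC hF hX hc) σ⟩
  rintro σ ⟨s, hs, hσ⟩
  exact A.continuous_randomChart hr0 hr1 hra hΦ
    ((A.mem_cont_pullback_fst_iff hC.dense s).1 hs) hσ

end MetricField

theorem mainTheorem4 {Z : Type u} [TopologicalSpace Z] (C : MetricField.{u, v} Z)
    (hC : C.IsContinuousField)
    {Ω : Type w} [TopologicalSpace Ω] [CompactSpace Ω] [T2Space Ω] [SecondCountableTopology Ω]
    [MeasurableSpace Ω] [BorelSpace Ω] (μ : Measure Ω) [IsProbabilityMeasure μ]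
    [NullSingletonClass μ] :
    (C.IsRandomizationStable μ →
      (C.IsTrivial ↔ C.IsLocallyTrivial ∧ C.HasIsometricFibers)) ∧
    (C.IsSecondCountable → C.IsLocallyTrivial → C.HasIsometricFibers →
      (C.continuumPower μ).IsTrivial) := by
  refine ⟨fun ⟨hsc, hstable⟩ => ⟨fun h => h.isLocallyTrivial_and_hasIsometricFibers, ?_⟩, ?_⟩
  · rintro ⟨hlt, X, _, hX, hCX⟩
    rcases isEmpty_or_nonempty Z with hZ | ⟨⟨z⟩⟩
    · exact MetricField.isTrivial_of_isEmpty fun s =>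
        hC.closed s (MetricField.mutuallyCocontinuous_of_isEmpty _)
    have : Nonempty Z := ⟨z⟩
    have := hsc.2 z
    have : SecondCountableTopology X := (hCX z).some.toHomeomorph.symm.secondCountableTopology
    have hpow := MetricField.isomorphic_continuumPower_const hC hsc hlt hX.geodesic hX.cat0 hCX μ
    have hiso := hstable.trans hpow
    -- Comparison of fibers identifies `L²(Ω, μ, X)` with `X`.
    obtain ⟨e, -⟩ := MetricField.isomorphic_const_iff.1 hiso
    exact ⟨X, inferInstance, hX, hiso.trans
      (MetricField.isomorphic_const_of_isometryEquiv ((e z).symm.trans (hCX z).some))⟩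
  · rintro hsc hlt ⟨X, _, hX, hCX⟩
    rcases isEmpty_or_nonempty Z with hZ | ⟨⟨z⟩⟩
    · exact MetricField.isTrivial_of_isEmpty fun s =>
        MetricField.mutuallyCocontinuous_of_isEmpty _
    have : Nonempty Z := ⟨z⟩
    have := hsc.2 z
    have : SecondCountableTopology X := (hCX z).some.toHomeomorph.symm.secondCountableTopology
    exact ⟨ContinuumProduct μ X, inferInstance, ContinuumProduct.isHilbertHadamard hX,
      MetricField.isomorphic_continuumPower_const hC hsc hlt hX.geodesic hX.cat0 hCX μ⟩
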